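/- **Conventions.** Manifolds are finite-dimensional and smooth; "closed manifold" means compact, Hausdorff, without boundary. A closed contact manifold $(V,\xi,\alpha)$ is a closed connected manifold with a contact form $\alpha$ and $\xi=\ker\alpha$; its Reeb field $R_\alpha$ is given by $\alpha(R_\alpha)=1$, $d\alpha(R_\alpha,\cdot)=0$. Let $\widetilde{\mathrm{Cont}}_0(V,\xi)$ be the universal cover of the identity component of the contactomorphism group: smooth contact isotopies $\{\phi_t\}_{t\in[0,1]}$ with $\phi_0=\mathrm{id}$, with time-wise composition, modulo smooth homotopy with fixed endpoints. A contact Hamiltonian $h\in C^\infty([0,1]\times V)$ generates the isotopy of the time-dependent field $X_{h_t}$ determined by $\alpha(X_{h_t})=h_t$, $d\alpha(X_{h_t},\cdot)=-dh_t+dh_t(R_\alpha)\alpha$; its class is denoted $\widetilde\phi_h$. Write $\widetilde\phi\preceq\widetilde\psi$ if $\widetilde\phi^{-1}\widetilde\psi=\widetilde\phi_h$ for some $h\ge 0$. A quasi-morphism $\mu:\widetilde{\mathrm{Cont}}_0(V,\xi)\to\mathbb R$ is a nonzero function with $\sup_{a,b}|\mu(ab)-\mu(a)-\mu(b)|<\infty$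 and $\mu(a^k)=k\mu(a)$ for all $k\in\mathbb Z$. It is monotone if $\widetilde\phi\preceq\widetilde\psi$ implies $\mu(\widetilde\phi)\le\mu(\widetilde\psi)$, and $C^0$-continuous if $h^{(n)}\to h$ uniformly on $[0,1]\times V$ implies $\mu(\widetilde\phi_{h^{(n)}})\to\mu(\widetilde\phi_h)$. A closed set $Z\subset V$ is $\mu$-subheavy if $\mu(\widetilde\phi_h)=0$ for every $h\in C^\infty(V)$ (autonomous) with $h|_Z=0$, and $\mu$-superheavy if $\mu(\widetilde\phi_h)>0$ for every $h\in C^\infty(V)$ with $h|_Z>0$. **Setting.** Let $(V,\xi,\alpha)$ and $(\overline V,\overline\xi,\overline\alpha)$ be closed contact manifolds. Let $Y\subset V$ be a closed submanifold that is strictly coisotropic with respect to $\alpha$: $Y$ is transverse to $\xi$, the subbundle $TY\cap\xi$ of $(\xi|_Y,d\alpha)$ is coisotropic, and $R_\alpha$ is tangent to $Y$. Let $\rho:Y\to\overline V$ be a smooth fiber bundle with $\rho^*\overline\alpha=\alpha|_Y$. Let $\mu:\widetilde{\mathrm{Cont}}_0(V,\xi)\to\mathbb R$ be a monotone, $C^0$-continuous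 quasi-morphism for which $Y$ is $\mu$-subheavy, and let $\overline\mu:\widetilde{\mathrm{Cont}}_0(\overline V,\overline\xi)\to\mathbb R$ be the function induced from $\mu$ by reduction, that is, $\overline\mu(\widetilde\phi_{\overline h})=\mu(\widetilde\phi_h)$ whenever $\overline h\in C^\infty([0,1]\times\overline V)$, $h\in C^\infty([0,1]\times V)$ and $h|_{[0,1]\times Y}=\rho^*\overline h$. **Theorem.** Let $Z\subset V$. If $Z$ is $\mu$-subheavy, then $\rho(Y\cap Z)\subset\overline V$ is $\overline\mu$-subheavy. If $Z$ is $\mu$-superheavy, then $\rho(Y\cap Z)\subset\overline V$ is $\overline\mu$-superheavy. -/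

import Mathlib

open scoped Manifold ContDiff
open Set Filter Topology

namespace ContactReduction

noncomputable section

/-! ### Linear algebra of a contact form at one point -/

section LinearAlgebra

variable {E : Type*} [NormedAddCommGroup E] [NormedSpace ℝ E] [FiniteDimensional ℝ E]

/-- The map `v ↦ Ω(v, ·) + a(v) a` from `E` to its dual. -/
def toDual (a : E →L[ℝ] ℝ) (Ω : E →L[ℝ] E →L[ℝ] ℝ) : E →ₗ[ℝ] (E →L[ℝ] ℝ) where
  toFun v := Ω v + a v • a
  map_add' v w := by ext u; simp; ring
  map_smul' c v := by ext u; simp; ring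

theorem toDual_bijective {a : E →L[ℝ] ℝ} {Ω : E →L[ℝ] E →L[ℝ] ℝ} (hΩ : ∀ v, Ω v v = 0)
    (hnd : ∀ v, a v = 0 → (∀ w, a w = 0 → Ω v w = 0) → v = 0) :
    Function.Bijective (toDual a Ω) := by
  have hinj : Function.Injective (toDual a Ω) := by
    rw [injective_iff_map_eq_zero]
    intro v hv
    have h : ∀ u, Ω v u + a v * a u = 0 := fun u => by
      simpa [toDual] using congrArg (fun f : E →L[ℝ] ℝ => f u) hv
    have hav : a v = 0 := by
      have := h v
      rw [hΩ v, zero_add] at this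
      exact mul_self_eq_zero.mp this
    exact hnd v hav fun w _ => by simpa [hav] using h w
  refine ⟨hinj, ?_⟩
  have hdim : Module.finrank ℝ E = Module.finrank ℝ (E →L[ℝ] ℝ) := by
    rw [← (LinearMap.toContinuousLinearMap (𝕜 := ℝ) (E := E) (F' := ℝ)).finrank_eq]
    exact (Subspace.dual_finrank_eq (K := ℝ) (V := E)).symm
  exact (LinearMap.injective_iff_surjective_of_finrank_eq_finrank hdim).mp hinj

/-- Existence and uniqueness of the Reeb vector. -/
theorem existsUnique_reeb {a : E →L[ℝ] ℝ} {Ω : E →L[ℝ] E →L[ℝ] ℝ} (hΩ : ∀ v, Ω v v = 0)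
    (ha : a ≠ 0) (hnd : ∀ v, a v = 0 → (∀ w, a w = 0 → Ω v w = 0) → v = 0) :
    ∃! R : E, a R = 1 ∧ ∀ u, Ω R u = 0 := by
  obtain ⟨hinj, hsurj⟩ := toDual_bijective hΩ hnd
  obtain ⟨R, hR⟩ := hsurj a
  have h : ∀ u, Ω R u + a R * a u = a u := fun u => by
    simpa [toDual] using congrArg (fun f : E →L[ℝ] ℝ => f u) hR
  have haR : a R = 1 := by
    have h1 := h R
    rw [hΩ R, zero_add] at h1
    rcases mul_right_eq_self₀.mp h1 with h2 | h2
    · exact h2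
    · exfalso
      have hR0 : R = 0 := hnd R h2 fun w hw => by simpa [hw] using h w
      apply ha
      ext u
      have := h u
      simp only [hR0, map_zero, zero_apply, zero_mul, add_zero] at this
      simpa using this.symm
  refine ⟨R, ⟨haR, fun u => by have := h u; rw [haR] at this; linarith⟩, ?_⟩
  rintro R' ⟨h1, h2⟩
  apply hinj
  rw [hR]
  ext u
  simp [toDual, h1, h2]

/-- Existence and uniqueness of the contact vector with given value `c` of the Hamiltonian and
given differential `b`. -/
theorem existsUnique_contactVector {a : E →L[ℝ] ℝ} {Ω : E →L[ℝ] E →L[ℝ] ℝ}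
    (hΩ : ∀ v, Ω v v = 0) (hnd : ∀ v, a v = 0 → (∀ w, a w = 0 → Ω v w = 0) → v = 0)
    {R : E} (hR : a R = 1 ∧ ∀ u, Ω R u = 0) (c : ℝ) (b : E →L[ℝ] ℝ) :
    ∃! X : E, a X = c ∧ ∀ u, Ω X u = -b u + b R * a u := by
  obtain ⟨hinj, hsurj⟩ := toDual_bijective hΩ hnd
  have hskew : ∀ u v, Ω u v = -Ω v u := fun u v => by
    have := hΩ (u + v)
    simp only [map_add, add_apply, hΩ] at this
    linarith
  obtain ⟨X, hX⟩ := hsurj (-b + (b R + c) • a)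
  have h : ∀ u, Ω X u + a X * a u = -b u + (b R + c) * a u := fun u => by
    simpa [toDual] using congrArg (fun f : E →L[ℝ] ℝ => f u) hX
  have haX : a X = c := by
    have := h R
    rw [hskew X R, hR.2, hR.1] at this
    linarith
  refine ⟨X, ⟨haX, fun u => by have := h u; rw [haX] at this; linarith⟩, ?_⟩
  rintro X' ⟨h1, h2⟩
  apply hinj
  rw [hX]
  ext u
  simp [toDual, h1, h2]
  ring

end LinearAlgebra

/-! ### Contact forms -/

section Forms

variable {E : Type*} [NormedAddCommGroup E] [NormedSpace ℝ E]
  {V : Type*} [TopologicalSpace V] [ChartedSpace E V]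

/-- The coordinate expression, in the preferred chart at `x`, of a 1-form on `V`: its pullback
under the inverse of the chart. -/
def formInChart (a : ∀ x : V, TangentSpace 𝓘(ℝ, E) x →L[ℝ] ℝ) (x : V) (y : E) : E →L[ℝ] ℝ :=
  (a ((extChartAt 𝓘(ℝ, E) x).symm y)).comp
    (mfderiv 𝓘(ℝ, E) 𝓘(ℝ, E) (extChartAt 𝓘(ℝ, E) x).symm y)

/-- The exterior derivative of a 1-form at `x`: in the preferred chart at `x` it is
`(da)(u, v) = (D_u a)(v) - (D_v a)(u)`, pulled back to `T_x V` by the differential of the chart. -/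
def dForm (a : ∀ x : V, TangentSpace 𝓘(ℝ, E) x →L[ℝ] ℝ) (x : V) :
    TangentSpace 𝓘(ℝ, E) x →L[ℝ] TangentSpace 𝓘(ℝ, E) x →L[ℝ] ℝ :=
  let A : E →L[ℝ] E →L[ℝ] ℝ := fderiv ℝ (formInChart a x) (extChartAt 𝓘(ℝ, E) x x)
  let d : E →L[ℝ] E := mfderiv 𝓘(ℝ, E) 𝓘(ℝ, E) (extChartAt 𝓘(ℝ, E) x) x
  let B : E →L[ℝ] E →L[ℝ] ℝ := (A - A.flip).bilinearComp d d
  B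

theorem dForm_apply (a : ∀ x : V, TangentSpace 𝓘(ℝ, E) x →L[ℝ] ℝ) (x : V)
    (u v : TangentSpace 𝓘(ℝ, E) x) :
    dForm a x u v =
      (fderiv ℝ (formInChart a x) (extChartAt 𝓘(ℝ, E) x x)
        (mfderiv 𝓘(ℝ, E) 𝓘(ℝ, E) (extChartAt 𝓘(ℝ, E) x) x u) : E →L[ℝ] ℝ)
        (mfderiv 𝓘(ℝ, E) 𝓘(ℝ, E) (extChartAt 𝓘(ℝ, E) x) x v) -
      (fderiv ℝ (formInChart a x) (extChartAt 𝓘(ℝ, E) x x)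
        (mfderiv 𝓘(ℝ, E) 𝓘(ℝ, E) (extChartAt 𝓘(ℝ, E) x) x v) : E →L[ℝ] ℝ)
        (mfderiv 𝓘(ℝ, E) 𝓘(ℝ, E) (extChartAt 𝓘(ℝ, E) x) x u) := rfl

theorem dForm_self (a : ∀ x : V, TangentSpace 𝓘(ℝ, E) x →L[ℝ] ℝ) (x : V)
    (v : TangentSpace 𝓘(ℝ, E) x) : dForm a x v v = 0 := by
  rw [dForm_apply, sub_self]

variable (E V) in
/-- A contact form on `V`: a smooth, nowhere vanishing 1-form `α` whose exterior derivative is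
nondegenerate on `ξ = ker α` at every point (equivalently `α ∧ (dα)ⁿ ≠ 0`, `dim V = 2n + 1`). -/
structure ContactForm [IsManifold 𝓘(ℝ, E) ∞ V] where
  /-- the 1-form -/
  form : ∀ x : V, TangentSpace 𝓘(ℝ, E) x →L[ℝ] ℝ
  smooth : ContMDiff 𝓘(ℝ, E) (𝓘(ℝ, E).prod 𝓘(ℝ, E →L[ℝ] ℝ)) ∞
    (fun x => Bundle.TotalSpace.mk' (E →L[ℝ] ℝ)
      (E := fun x : V => TangentSpace 𝓘(ℝ, E) x →L[ℝ] ℝ) x (form x))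
  ne_zero : ∀ x, form x ≠ 0
  nondegenerate : ∀ (x : V) (v : TangentSpace 𝓘(ℝ, E) x), form x v = 0 →
    (∀ w : TangentSpace 𝓘(ℝ, E) x, form x w = 0 → dForm form x v w = 0) → v = 0

namespace ContactForm

variable [IsManifold 𝓘(ℝ, E) ∞ V] (α : ContactForm E V)

/-- The contact structure `ξ = ker α`. -/
def ker (x : V) : Submodule ℝ (TangentSpace 𝓘(ℝ, E) x) := (α.form x).toLinearMap.ker

variable [FiniteDimensional ℝ E]

theorem existsUnique_reeb (x : V) :
    ∃! R : TangentSpace 𝓘(ℝ, E) x, α.form x R = 1 ∧ ∀ u, dForm α.form x R u = 0 :=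
  ContactReduction.existsUnique_reeb (E := E) (dForm_self α.form x) (α.ne_zero x)
    (α.nondegenerate x)

/-- The Reeb vector field: `α(R) = 1` and `dα(R, ·) = 0`. -/
def reeb (x : V) : TangentSpace 𝓘(ℝ, E) x := (α.existsUnique_reeb x).choose

theorem reeb_spec (x : V) : α.form x (α.reeb x) = 1 ∧ ∀ u, dForm α.form x (α.reeb x) u = 0 :=
  (α.existsUnique_reeb x).choose_spec.1

/-- The differential at `x` of a real function on `V`. -/
def dFun (h : V → ℝ) (x : V) : TangentSpace 𝓘(ℝ, E) x →L[ℝ] ℝ := mfderiv 𝓘(ℝ, E) 𝓘(ℝ, ℝ) h x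

theorem existsUnique_contactVector (h : V → ℝ) (x : V) :
    ∃! X : TangentSpace 𝓘(ℝ, E) x, α.form x X = h x ∧ ∀ u, dForm α.form x X u =
      -dFun h x u + dFun h x (α.reeb x) * α.form x u :=
  ContactReduction.existsUnique_contactVector (E := E) (dForm_self α.form x)
    (α.nondegenerate x) (α.reeb_spec x) (h x) (dFun h x)

/-- The contact vector field of a function: `α(X_h) = h` and `dα(X_h, ·) = -dh + dh(R) α`. -/
def contactVectorField (h : V → ℝ) (x : V) : TangentSpace 𝓘(ℝ, E) x :=
  (α.existsUnique_contactVector h x).choose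

theorem contactVectorField_spec (h : V → ℝ) (x : V) :
    α.form x (α.contactVectorField h x) = h x ∧
      ∀ u, dForm α.form x (α.contactVectorField h x) u =
        -dFun h x u + dFun h x (α.reeb x) * α.form x u :=
  (α.existsUnique_contactVector h x).choose_spec.1

end ContactForm

end Forms

/-! ### The universal cover of the identity component of the contactomorphism group -/

section Group

variable {E : Type*} [NormedAddCommGroup E] [NormedSpace ℝ E]
  {V : Type*} [TopologicalSpace V] [ChartedSpace E V]

/-- A contactomorphism: a diffeomorphism `f` with `df(ξ) = ξ`. -/
structure IsContactomorphism (ξ : ∀ x : V, Submodule ℝ (TangentSpace 𝓘(ℝ, E) x))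
    (f : Equiv.Perm V) : Prop where
  smooth : ContMDiff 𝓘(ℝ, E) 𝓘(ℝ, E) ∞ f
  smooth_inv : ContMDiff 𝓘(ℝ, E) 𝓘(ℝ, E) ∞ (f⁻¹ : Equiv.Perm V)
  preserves : ∀ (x : V) (v : TangentSpace 𝓘(ℝ, E) x),
    mfderiv 𝓘(ℝ, E) 𝓘(ℝ, E) f x v ∈ ξ (f x) ↔ v ∈ ξ x

namespace IsContactomorphism

variable {ξ : ∀ x : V, Submodule ℝ (TangentSpace 𝓘(ℝ, E) x)} {f g : Equiv.Perm V}

theorem one : IsContactomorphism ξ (1 : Equiv.Perm V) where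
  smooth := contMDiff_id
  smooth_inv := contMDiff_id
  preserves x v := by
    have : mfderiv 𝓘(ℝ, E) 𝓘(ℝ, E) (⇑(1 : Equiv.Perm V)) x
        = ContinuousLinearMap.id ℝ (TangentSpace 𝓘(ℝ, E) x) := mfderiv_id
    rw [this]
    rfl

theorem mul (hf : IsContactomorphism ξ f) (hg : IsContactomorphism ξ g) :
    IsContactomorphism ξ (f * g) where
  smooth := hf.smooth.comp hg.smooth
  smooth_inv := by
    rw [mul_inv_rev]
    exact hg.smooth_inv.comp hf.smooth_inv
  preserves x v := by
    have h : mfderiv 𝓘(ℝ, E) 𝓘(ℝ, E) (⇑(f * g)) x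
        = (mfderiv 𝓘(ℝ, E) 𝓘(ℝ, E) f (g x)).comp (mfderiv 𝓘(ℝ, E) 𝓘(ℝ, E) g x) :=
      mfderiv_comp x (hf.smooth.mdifferentiable (by simp) _) (hg.smooth.mdifferentiable (by simp) _)
    rw [h]
    exact (hf.preserves (g x) _).trans (hg.preserves x v)

theorem inv (hf : IsContactomorphism ξ f) : IsContactomorphism ξ f⁻¹ where
  smooth := hf.smooth_inv
  smooth_inv := by rw [inv_inv]; exact hf.smooth
  preserves x v := by
    have h : mfderiv 𝓘(ℝ, E) 𝓘(ℝ, E) (⇑(f * f⁻¹)) x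
        = (mfderiv 𝓘(ℝ, E) 𝓘(ℝ, E) f (f⁻¹ x)).comp
          (mfderiv 𝓘(ℝ, E) 𝓘(ℝ, E) (f⁻¹ : Equiv.Perm V) x) :=
      mfderiv_comp x (hf.smooth.mdifferentiable (by simp) _)
        (hf.smooth_inv.mdifferentiable (by simp) _)
    have h2 := (one (ξ := ξ)).preserves x v
    rw [← mul_inv_cancel f, h] at h2
    exact (hf.preserves (f⁻¹ x) _).symm.trans h2

end IsContactomorphism

/-- The group of contact isotopies `{φ_t}`, `t ∈ [0,1]`, based at the identity, with time-wise
composition. (Smoothness of `(t, x) ↦ φ_t⁻¹ x` is automatic from the other conditions.) -/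
def isotopyGroup (ξ : ∀ x : V, Submodule ℝ (TangentSpace 𝓘(ℝ, E) x)) :
    Subgroup (unitInterval → Equiv.Perm V) where
  carrier := {φ | (∀ t, IsContactomorphism ξ (φ t)) ∧ φ 0 = 1 ∧
    ContMDiff ((𝓡∂ 1).prod 𝓘(ℝ, E)) 𝓘(ℝ, E) ∞ (fun p : unitInterval × V => φ p.1 p.2) ∧
    ContMDiff ((𝓡∂ 1).prod 𝓘(ℝ, E)) 𝓘(ℝ, E) ∞ (fun p : unitInterval × V => (φ p.1)⁻¹ p.2)}
  mul_mem' := by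
    rintro φ ψ ⟨h1, h2, h3, h4⟩ ⟨k1, k2, k3, k4⟩
    refine ⟨fun t => (h1 t).mul (k1 t), by simp [h2, k2], ?_, ?_⟩
    · exact h3.comp (contMDiff_fst.prodMk k3)
    · simp only [Pi.mul_apply, mul_inv_rev]
      exact k4.comp (contMDiff_fst.prodMk h4)
  one_mem' := ⟨fun _ => IsContactomorphism.one, rfl, contMDiff_snd, contMDiff_snd⟩
  inv_mem' := by
    rintro φ ⟨h1, h2, h3, h4⟩
    exact ⟨fun t => (h1 t).inv, by simp [h2], h4, by simpa using h3⟩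

/-- The contractible loops: the isotopies `φ` for which there is a smooth family `Φ^s`,
`s ∈ [0,1]`, of contact isotopies, all from `id` to `id`, with `Φ^0` constant and `Φ^1 = φ`. -/
def contractibleLoops (ξ : ∀ x : V, Submodule ℝ (TangentSpace 𝓘(ℝ, E) x)) :
    Subgroup (isotopyGroup ξ) where
  carrier := {φ | ∃ Φ : unitInterval → isotopyGroup ξ,
    ContMDiff ((𝓡∂ 1).prod ((𝓡∂ 1).prod 𝓘(ℝ, E))) 𝓘(ℝ, E) ∞
      (fun p : unitInterval × unitInterval × V => (Φ p.1).1 p.2.1 p.2.2) ∧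
    ContMDiff ((𝓡∂ 1).prod ((𝓡∂ 1).prod 𝓘(ℝ, E))) 𝓘(ℝ, E) ∞
      (fun p : unitInterval × unitInterval × V => ((Φ p.1).1 p.2.1)⁻¹ p.2.2) ∧
    Φ 0 = 1 ∧ Φ 1 = φ ∧ ∀ s, (Φ s).1 1 = 1}
  mul_mem' := by
    rintro φ ψ ⟨Φ, h1, h2, h3, h4, h5⟩ ⟨Ψ, k1, k2, k3, k4, k5⟩
    refine ⟨fun s => Φ s * Ψ s, ?_, ?_, by simp [h3, k3], by simp [h4, k4], ?_⟩
    · exact h1.comp (contMDiff_fst.prodMk ((contMDiff_fst.comp contMDiff_snd).prodMk k1))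
    · simp only [Subgroup.coe_mul, Pi.mul_apply, mul_inv_rev]
      exact k2.comp (contMDiff_fst.prodMk ((contMDiff_fst.comp contMDiff_snd).prodMk h2))
    · intro s
      simp [h5 s, k5 s]
  one_mem' := ⟨fun _ => 1, contMDiff_snd.comp contMDiff_snd, contMDiff_snd.comp contMDiff_snd,
    rfl, rfl, fun _ => rfl⟩
  inv_mem' := by
    rintro φ ⟨Φ, h1, h2, h3, h4, h5⟩
    refine ⟨fun s => (Φ s)⁻¹, h2, by simpa using h1, by simp [h3], by simp [h4], ?_⟩
    intro s
    simp [h5 s]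

instance (ξ : ∀ x : V, Submodule ℝ (TangentSpace 𝓘(ℝ, E) x)) : (contractibleLoops ξ).Normal where
  conj_mem := by
    rintro φ ⟨Φ, h1, h2, h3, h4, h5⟩ g
    obtain ⟨-, -, g1, g2⟩ := g.2
    have hp : ContMDiff ((𝓡∂ 1).prod ((𝓡∂ 1).prod 𝓘(ℝ, E))) (𝓡∂ 1) ∞
      (fun p : unitInterval × unitInterval × V => p.2.1) := contMDiff_fst.comp contMDiff_snd
    have hgi : ContMDiff ((𝓡∂ 1).prod ((𝓡∂ 1).prod 𝓘(ℝ, E))) 𝓘(ℝ, E) ∞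
      (fun p : unitInterval × unitInterval × V => (g.1 p.2.1)⁻¹ p.2.2) := g2.comp contMDiff_snd
    refine ⟨fun s => g * Φ s * g⁻¹, ?_, ?_, by simp [h3], by simp [h4], ?_⟩
    · exact g1.comp (hp.prodMk (h1.comp (contMDiff_fst.prodMk (hp.prodMk hgi))))
    · simp only [Subgroup.coe_mul, Subgroup.coe_inv, Pi.mul_apply, Pi.inv_apply, mul_inv_rev,
        inv_inv]
      exact g1.comp (hp.prodMk (h2.comp (contMDiff_fst.prodMk (hp.prodMk hgi))))
    · intro s
      simp [h5 s]

/-- The universal cover of the identity component of the group of contactomorphisms of `(V, ξ)`: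
contact isotopies based at the identity modulo homotopy with fixed endpoints. Two isotopies `φ, ψ`
are homotopic with fixed endpoints exactly when `φ⁻¹ψ` is a contractible loop. -/
abbrev UnivCont (ξ : ∀ x : V, Submodule ℝ (TangentSpace 𝓘(ℝ, E) x)) : Type _ :=
  isotopyGroup ξ ⧸ contractibleLoops ξ

/-- The element of the universal cover represented by a contact isotopy. -/
def isotopyClass {ξ : ∀ x : V, Submodule ℝ (TangentSpace 𝓘(ℝ, E) x)} (φ : isotopyGroup ξ) :
    UnivCont ξ := QuotientGroup.mk φ

variable (E V) in
/-- Smooth time-dependent contact Hamiltonians `[0,1] × V → ℝ`. -/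
abbrev Hamiltonian : Type _ :=
  C^∞⟮(𝓡∂ 1).prod 𝓘(ℝ, E), unitInterval × V; 𝓘(ℝ, ℝ), ℝ⟯

/-- An autonomous (time-independent) function regarded as a contact Hamiltonian. -/
def autonomous (h : C^∞⟮𝓘(ℝ, E), V; 𝓘(ℝ, ℝ), ℝ⟯) : Hamiltonian E V := h.comp ContMDiffMap.snd

variable [FiniteDimensional ℝ E] [IsManifold 𝓘(ℝ, E) ∞ V] (α : ContactForm E V)

namespace ContactForm

/-- The contact isotopy `φ` is generated by the contact Hamiltonian `h`, i.e. it is the flow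
`∂φ_t/∂t = X_{h_t} ∘ φ_t`. On a closed manifold each `h` generates exactly one `φ`. Its
class `isotopyClass φ` is the element of the universal cover generated by `h`. -/
def Generates (h : Hamiltonian E V) (φ : isotopyGroup α.ker) : Prop :=
  ∀ (t : unitInterval) (x : V),
    mfderiv (𝓡∂ 1) 𝓘(ℝ, E) (fun s : unitInterval => φ.1 s x) t (oneTangentSpaceIcc t)
      = α.contactVectorField (fun y => h (t, y)) (φ.1 t x)

/-- The relation `a ⪯ b`: the element `a⁻¹ b` is generated by a nonnegative contact Hamiltonian. -/
def Le (a b : UnivCont α.ker) : Prop :=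
  ∃ h : Hamiltonian E V, (∀ p, 0 ≤ h p) ∧
    ∃ φ : isotopyGroup α.ker, α.Generates h φ ∧ a⁻¹ * b = isotopyClass φ

/-- `μ` is monotone. -/
def IsMonotone (μ : UnivCont α.ker → ℝ) : Prop := ∀ a b, α.Le a b → μ a ≤ μ b

/-- `μ` is `C⁰`-continuous: uniform convergence of contact Hamiltonians `hₙ → h` implies
convergence of the values of `μ` on the elements they generate. -/
def IsC0Continuous (μ : UnivCont α.ker → ℝ) : Prop :=
  ∀ (h : Hamiltonian E V) (hn : ℕ → Hamiltonian E V),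
    TendstoUniformly (fun n p => hn n p) (fun p => h p) atTop →
    ∀ (φ : isotopyGroup α.ker) (φn : ℕ → isotopyGroup α.ker),
      α.Generates h φ → (∀ n, α.Generates (hn n) (φn n)) →
      Tendsto (fun n => μ (isotopyClass (φn n))) atTop (𝓝 (μ (isotopyClass φ)))

/-- `Z` is `μ`-subheavy: closed, and `μ` vanishes on the elements generated by autonomous contact
Hamiltonians that vanish on `Z`. -/
def IsSubheavy (μ : UnivCont α.ker → ℝ) (Z : Set V) : Prop :=
  IsClosed Z ∧ ∀ h : C^∞⟮𝓘(ℝ, E), V; 𝓘(ℝ, ℝ), ℝ⟯, (∀ z ∈ Z, h z = 0) →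
    ∀ φ : isotopyGroup α.ker, α.Generates (autonomous h) φ → μ (isotopyClass φ) = 0

/-- `Z` is `μ`-superheavy: closed, and `μ` is positive on the elements generated by autonomous
contact Hamiltonians that are positive on `Z`. -/
def IsSuperheavy (μ : UnivCont α.ker → ℝ) (Z : Set V) : Prop :=
  IsClosed Z ∧ ∀ h : C^∞⟮𝓘(ℝ, E), V; 𝓘(ℝ, ℝ), ℝ⟯, (∀ z ∈ Z, 0 < h z) →
    ∀ φ : isotopyGroup α.ker, α.Generates (autonomous h) φ → 0 < μ (isotopyClass φ)

end ContactForm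

end Group

/-- A nonzero homogeneous quasi-morphism. -/
structure IsQuasimorphism {G : Type*} [Group G] (μ : G → ℝ) : Prop where
  bounded : ∃ D : ℝ, 0 < D ∧ ∀ a b, |μ (a * b) - μ a - μ b| ≤ D
  homogeneous : ∀ (a : G) (k : ℤ), μ (a ^ k) = k * μ a
  ne_zero : ∃ a, μ a ≠ 0

/-! ### The reduction setting -/

section Reduction

variable {E : Type*} [NormedAddCommGroup E] [NormedSpace ℝ E] [FiniteDimensional ℝ E]
  {V : Type*} [TopologicalSpace V] [ChartedSpace E V] [IsManifold 𝓘(ℝ, E) ∞ V]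
  {EB : Type*} [NormedAddCommGroup EB] [NormedSpace ℝ EB] [FiniteDimensional ℝ EB]
  {B : Type*} [TopologicalSpace B] [ChartedSpace EB B] [IsManifold 𝓘(ℝ, EB) ∞ B]
  {EY : Type*} [NormedAddCommGroup EY] [NormedSpace ℝ EY]
  {Y : Type*} [TopologicalSpace Y] [ChartedSpace EY Y]

variable (EY) in
/-- The tangent space `T_yY`, as a subspace of `T_{ι y}V`, of a submanifold given by `ι : Y → V`. -/
def tangentRange (ι : Y → V) (y : Y) : Submodule ℝ (TangentSpace 𝓘(ℝ, E) (ι y)) :=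
  (mfderiv 𝓘(ℝ, EY) 𝓘(ℝ, E) ι y).toLinearMap.range

variable (EY) in
/-- The submanifold `ι : Y → V` is strictly coisotropic with respect to `α`: it is transverse to
`ξ = ker α`, the subbundle `TY ∩ ξ` of `(ξ, dα)` is coisotropic, and the Reeb vector field is tangent
to it. -/
structure IsStrictlyCoisotropic (α : ContactForm E V) (ι : Y → V) : Prop where
  transverse : ∀ y, tangentRange EY ι y ⊔ α.ker (ι y) = ⊤
  coisotropic : ∀ y, ∀ X ∈ α.ker (ι y),
    (∀ W ∈ tangentRange EY ι y ⊓ α.ker (ι y), dForm α.form (ι y) X W = 0) →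
      X ∈ tangentRange EY ι y ⊓ α.ker (ι y)
  reeb_tangent : ∀ y, α.reeb (ι y) ∈ tangentRange EY ι y

variable (EB EY) in
/-- `ρ : Y → B` is a smooth fiber bundle whose fiber is the manifold `F`. -/
structure IsSmoothFiberBundle (EF F : Type*) [NormedAddCommGroup EF] [NormedSpace ℝ EF]
    [TopologicalSpace F] [ChartedSpace EF F] (ρ : Y → B) : Prop where
  smooth : ContMDiff 𝓘(ℝ, EY) 𝓘(ℝ, EB) ∞ ρ
  locally_trivial : ∀ b : B, ∃ e : Bundle.Trivialization F ρ, b ∈ e.baseSet ∧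
    ContMDiffOn 𝓘(ℝ, EY) (𝓘(ℝ, EB).prod 𝓘(ℝ, EF)) ∞ e e.source ∧
    ContMDiffOn (𝓘(ℝ, EB).prod 𝓘(ℝ, EF)) 𝓘(ℝ, EY) ∞ e.toOpenPartialHomeomorph.symm e.target

variable (EY) in
/-- The condition `ρ^* β = α|_Y` on 1-forms. -/
def PullbackEq (α : ContactForm E V) (β : ContactForm EB B) (ι : Y → V) (ρ : Y → B) : Prop :=
  ∀ (y : Y) (u : TangentSpace 𝓘(ℝ, EY) y),
    β.form (ρ y) (mfderiv 𝓘(ℝ, EY) 𝓘(ℝ, EB) ρ y u)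
      = α.form (ι y) (mfderiv 𝓘(ℝ, EY) 𝓘(ℝ, E) ι y u)

/-- `ν` is induced from `μ` by reduction: its value on the element generated by `k` on `B` is the value
of `μ` on the element generated by `h` on `V`, for every extension `h` of `k`, i.e. every `h` whose
restriction to `[0,1] × Y` is `ρ^* k`. -/
def IsInducedBy (α : ContactForm E V) (β : ContactForm EB B) (ι : Y → V) (ρ : Y → B)
    (μ : UnivCont α.ker → ℝ) (ν : UnivCont β.ker → ℝ) : Prop :=
  ∀ (h : Hamiltonian E V) (k : Hamiltonian EB B),
    (∀ (t : unitInterval) (y : Y), h (t, ι y) = k (t, ρ y)) →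
    ∀ (φ : isotopyGroup α.ker) (ψ : isotopyGroup β.ker), α.Generates h φ → β.Generates k ψ →
      ν (isotopyClass ψ) = μ (isotopyClass φ)

end Reduction

end

end ContactReduction

open ContactReduction

/-! By the reduction identity, the value of `ν` at a Hamiltonian `k` on `B` is the value of `μ` at
any extension to `V` of the pullback of `k` to `Y`. Everything therefore depends on choosing the
extension well.

If `k` is positive on `ρ(Y ∩ Z)`, its pullback is positive on `Y ∩ Z`. Positivity is an open, convex
condition, so a partition of unity gives an extension that is positive on `Z`
(`exists_extension_pos`), and superheaviness of `Z` applies.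

If `k` only vanishes on `ρ(Y ∩ Z)`, an extension vanishing on `Z` need not exist, since `Z` is an
arbitrary closed set. Replace `k` by `T ∘ k`, where `T` is a smooth function near the identity that
vanishes near `0`. The pullback then vanishes near `Y ∩ Z` and does extend by zero over `Z`
(`exists_extension_zero`), so `μ` is zero there. The reduction identity transfers this value to the
extension `T ∘ h`, where `h` is any extension of the pullback of `k`. As `T` tends to the identity,
`T ∘ h` tends to `h` uniformly (`abs_truncation_sub_le`), and continuity of `μ` gives zero for `h`.

The definitions speak of isotopies generated by a Hamiltonian, so the auxiliary Hamiltonians must be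
shown to generate some (`ContactForm.exists_generates`). This takes up most of the file: smooth
dependence of solutions of differential equations via the implicit function theorem on a space of
curves (`exists_flow_of_contDiff`), global flows on compact manifolds (`exists_flow`), smoothness of
contact vector fields, and preservation of `ξ` by Cartan's formula (`hasDerivAt_form_flow`). -/

namespace ContactReduction

/-! ### Smoothness of `u ↦ f ∘ u` on spaces of continuous maps. -/

section Superposition

universe u

/-- Pointwise application of a continuous family of linear maps to a continuous family of
vectors. -/
noncomputable def pointwiseApply (K : Type*) [TopologicalSpace K] [CompactSpace K]
    (E F : Type*) [NormedAddCommGroup E] [NormedSpace ℝ E] [NormedAddCommGroup F]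
    [NormedSpace ℝ F] : C(K, E →L[ℝ] F) →L[ℝ] C(K, E) →L[ℝ] C(K, F) :=
  LinearMap.mkContinuous₂
    (LinearMap.mk₂ ℝ
      (fun (A : C(K, E →L[ℝ] F)) (u : C(K, E)) => (⟨fun t => A t (u t), A.continuous.clm_apply u.continuous⟩ : C(K, F)))
      (fun _ _ _ => by ext; simp) (fun _ _ _ => by ext; simp)
      (fun _ _ _ => by ext; simp) (fun _ _ _ => by ext; simp)) 1
    (fun A u => by
      rw [one_mul, ContinuousMap.norm_le _ (by positivity)]
      exact fun t => (A t).le_of_opNorm_le_of_le (A.norm_coe_le_norm t) (u.norm_coe_le_norm t))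

variable {K : Type*} [TopologicalSpace K] [CompactSpace K]

/-- The mean value inequality bounds the remainder at each `t`. The bound is uniform in `t` because
`u ↦ f' ∘ u` is continuous for the sup norm. -/
theorem hasFDerivAt_postcomp {E F : Type*} [NormedAddCommGroup E] [NormedSpace ℝ E]
    [NormedAddCommGroup F] [NormedSpace ℝ F] (f : C(E, F)) (f' : C(E, E →L[ℝ] F))
    (hf : ∀ x, HasFDerivAt f (f' x) x) (u : C(K, E)) :
    HasFDerivAt (fun u : C(K, E) => f.comp u) (pointwiseApply K E F (f'.comp u)) u := by
  rw [hasFDerivAt_iff_isLittleO_nhds_zero, Asymptotics.isLittleO_iff]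
  intro ε hε
  have hc : ContinuousAt (fun u : C(K, E) => f'.comp u) u :=
    (ContinuousMap.continuous_postcomp (X := K) f').continuousAt
  obtain ⟨δ, hδ, h⟩ := (Metric.continuousAt_iff (α := C(K, E)) (β := C(K, E →L[ℝ] F))).mp hc ε hε
  filter_upwards [Metric.ball_mem_nhds (0 : C(K, E)) hδ] with v hv
  rw [mem_ball_zero_iff] at hv
  rw [ContinuousMap.norm_le _ (by positivity)]
  intro t
  have key : ‖f (u t + v t) - f (u t) - f' (u t) (u t + v t - u t)‖
      ≤ ε * ‖u t + v t - u t‖ := by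
    refine (convex_segment (u t) (u t + v t)).norm_image_sub_le_of_norm_hasFDerivWithin_le'
      (fun x _ => (hf x).hasFDerivWithinAt) ?_ (left_mem_segment ..) (right_mem_segment ..)
    intro x hx
    rw [segment_eq_image'] at hx
    obtain ⟨θ, hθ, rfl⟩ := hx
    -- The parameter `θ` belongs to the fixed `t`, but the whole curve `u + θ v` is what is compared
    -- with `u`, so the choice of `δ` applies.
    have hd : dist (u + θ • v) u < δ := by
      rw [dist_eq_norm, add_sub_cancel_left, norm_smul, Real.norm_of_nonneg hθ.1]
      exact (mul_le_of_le_one_left (norm_nonneg v) hθ.2).trans_lt hv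
    have := (ContinuousMap.dist_apply_le_dist t).trans (h hd).le
    rw [dist_eq_norm] at this
    simpa using this
  rw [add_sub_cancel_left] at key
  exact key.trans (mul_le_mul_of_nonneg_left (v.norm_coe_le_norm t) hε.le)

/-- The derivative is again a postcomposition, by `f'`, followed by a bounded linear map. The
induction thus replaces `F` by `E →L[ℝ] F`, and the common universe keeps this space within reach of
the induction hypothesis. -/
theorem contDiff_postcomp_nat (n : ℕ) {E F : Type u} [NormedAddCommGroup E] [NormedSpace ℝ E]
    [NormedAddCommGroup F] [NormedSpace ℝ F] (f : C(E, F)) (hf : ContDiff ℝ n f) :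
    ContDiff ℝ n (fun u : C(K, E) => f.comp u) := by
  induction n generalizing F with
  | zero => exact contDiff_zero.mpr (ContinuousMap.continuous_postcomp f)
  | succ n ih =>
    rw [Nat.cast_add, Nat.cast_one, contDiff_succ_iff_hasFDerivAt] at hf ⊢
    obtain ⟨f', hf', hd⟩ := hf
    let g : C(E, E →L[ℝ] F) := ⟨f', hf'.continuous⟩
    exact ⟨fun u => pointwiseApply K E F (g.comp u),
      ContDiff.comp (g := pointwiseApply K E F) (ContinuousLinearMap.contDiff (𝕜 := ℝ)
        (E := C(K, E →L[ℝ] F)) (F := C(K, E) →L[ℝ] C(K, F)) (pointwiseApply K E F)) (ih g hf'),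
      hasFDerivAt_postcomp f g hd⟩

/-- Composition with a smooth map is a smooth operation on continuous maps from a compact space. -/
theorem contDiff_postcomp {E F : Type u} [NormedAddCommGroup E] [NormedSpace ℝ E]
    [NormedAddCommGroup F] [NormedSpace ℝ F] (f : C(E, F)) (hf : ContDiff ℝ ∞ f) :
    ContDiff ℝ ∞ (fun u : C(K, E) => f.comp u) :=
  contDiff_infty.mpr fun n => contDiff_postcomp_nat n f (contDiff_infty.mp hf n)

end Superposition

/-! ### Local flows on a vector space, with smooth dependence. -/

section LocalFlow

variable {E : Type*} [NormedAddCommGroup E] [NormedSpace ℝ E]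

/-- The primitive vanishing at `0` of a continuous function on `[-1, 1]`. -/
noncomputable def primitive (E : Type*) [NormedAddCommGroup E] [NormedSpace ℝ E] :
    C(Icc (-1 : ℝ) 1, E) →L[ℝ] C(Icc (-1 : ℝ) 1, E) :=
  LinearMap.mkContinuous
    { toFun := fun u => ⟨fun t => ∫ τ in (0 : ℝ)..t, IccExtend (by norm_num) u τ,
        (intervalIntegral.continuous_primitive
          (fun _ _ => (u.continuous.Icc_extend' ).intervalIntegrable _ _) 0).comp
          continuous_subtype_val⟩
      map_add' := fun u v => by
        ext t
        simp only [ContinuousMap.coe_mk, ContinuousMap.add_apply]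
        rw [← intervalIntegral.integral_add
          (u.continuous.Icc_extend'.intervalIntegrable _ _)
          (v.continuous.Icc_extend'.intervalIntegrable _ _)]
        rfl
      map_smul' := fun c u => by
        ext t
        simp only [ContinuousMap.coe_mk, ContinuousMap.smul_apply, RingHom.id_apply]
        rw [← intervalIntegral.integral_smul]
        rfl } 1
    (fun u => by
      rw [one_mul, ContinuousMap.norm_le _ (norm_nonneg u)]
      intro t
      refine (intervalIntegral.norm_integral_le_of_norm_le_const (C := ‖u‖)
        fun τ _ => u.norm_coe_le_norm _).trans ?_
      have : |(t : ℝ) - 0| ≤ 1 := by rw [sub_zero]; exact abs_le.mpr t.2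
      exact mul_le_of_le_one_right (norm_nonneg u) this)

theorem primitive_apply (u : C(Icc (-1 : ℝ) 1, E)) (t : Icc (-1 : ℝ) 1) :
    primitive E u t = ∫ τ in (0 : ℝ)..t, IccExtend (by norm_num) u τ := rfl

/-- The integral equation `u = x + s ∫ f(u)` is an equation `G((s, x), u) = 0` for a smooth `G`. At
`s = 0` the partial derivative in `u` is the identity, so the implicit function theorem solves for
`u` smoothly in `(s, x)`. Scaling the field by `s` instead of shortening the time keeps all curves
in one Banach space. -/
theorem exists_flow_of_contDiff [CompleteSpace E] {f : E → E} (hf : ContDiff ℝ ∞ f) (x₀ : E) :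
    ∃ c : ℝ × E → C(Icc (-1 : ℝ) 1, E), ContDiffAt ℝ ∞ c (0, x₀) ∧
      c (0, x₀) = ContinuousMap.const _ x₀ ∧
      ∀ᶠ p in 𝓝 ((0 : ℝ), x₀), ∀ t : Icc (-1 : ℝ) 1,
        c p t = p.2 + p.1 • ∫ τ in (0 : ℝ)..t, f (IccExtend (by norm_num) (c p) τ) := by
  let X := C(Icc (-1 : ℝ) 1, E)
  let fc : C(E, E) := ⟨f, hf.continuous⟩
  let cst : E →L[ℝ] X := ContinuousLinearMap.const ℝ (Icc (-1 : ℝ) 1)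
  let G : (ℝ × E) × X → X := fun q => q.2 - cst q.1.2 - q.1.1 • primitive E (fc.comp q.2)
  have hN : ContDiff ℝ ∞ (fun u : X => fc.comp u) := contDiff_postcomp fc hf
  have hG : ContDiff ℝ ∞ G := by
    refine (contDiff_snd.sub (cst.contDiff.comp (contDiff_snd.comp contDiff_fst))).sub ?_
    exact (contDiff_fst.comp contDiff_fst).smul
      ((primitive E).contDiff.comp (hN.comp contDiff_snd))
  let q₀ : (ℝ × E) × X := ((0, x₀), cst x₀)
  have hG0 : G q₀ = 0 := by simp [G, q₀]
  have hcd : ContDiffAt ℝ ∞ G q₀ := hG.contDiffAt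
  have hder : fderiv ℝ G q₀ ∘L .inr ℝ (ℝ × E) X = ContinuousLinearMap.id ℝ X := by
    have h1 : HasFDerivAt (fun u : X => G ((0, x₀), u))
        (fderiv ℝ G q₀ ∘L .inr ℝ (ℝ × E) X) (cst x₀) :=
      HasFDerivAt.comp (cst x₀) (f := fun u : X => (((0 : ℝ), x₀), u)) (g := G)
        ((hG.differentiable (by simp) q₀).hasFDerivAt)
        (hasFDerivAt_prodMk_right ((0 : ℝ), x₀) (cst x₀))
    have h2 : HasFDerivAt (fun u : X => G ((0, x₀), u)) (ContinuousLinearMap.id ℝ X) (cst x₀) := by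
      have : (fun u : X => G ((0, x₀), u)) = fun u => u - cst x₀ := by
        funext u; simp [G]
      rw [this]
      exact (hasFDerivAt_id _).sub_const _
    exact h1.unique h2
  have hinv : (fderiv ℝ G q₀ ∘L .inr ℝ (ℝ × E) X).IsInvertible := by
    rw [hder]; exact ⟨ContinuousLinearEquiv.refl ℝ X, rfl⟩
  refine ⟨hcd.implicitFunction (by simp) hinv, hcd.contDiffAt_implicitFunction _ _,
    hcd.implicitFunction_apply_self _ _, ?_⟩
  filter_upwards [hcd.eventually_apply_implicitFunction (by simp) hinv] with p hp t
  rw [hG0] at hp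
  generalize hcd.implicitFunction _ hinv p = w at hp ⊢
  simp only [G, sub_sub, sub_eq_zero] at hp
  refine (DFunLike.congr_fun hp t).trans ?_
  change p.2 + p.1 • primitive E _ t = _
  rw [primitive_apply]
  rfl

/-- The local flow of a smooth vector field `f`, with time rescaled: `c (s, x)` is the integral
curve of `s • f` on `(-1, 1)` through `x`, and it depends smoothly on `(s, x)`. -/
theorem exists_local_flow [FiniteDimensional ℝ E] {f : E → E} {U : Set E} (hU : IsOpen U)
    (hf : ContDiffOn ℝ ∞ f U) {x₀ : E} (hx₀ : x₀ ∈ U) :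
    ∃ c : ℝ × E → ℝ → E, ContDiffAt ℝ ∞ (fun p => c p (1 / 2)) (0, x₀) ∧
      ∀ᶠ p in 𝓝 ((0 : ℝ), x₀), c p 0 = p.2 ∧ ∀ t ∈ Ioo (-1 : ℝ) 1,
        c p t ∈ U ∧ HasDerivAt (c p) (p.1 • f (c p t)) t := by
  have : CompleteSpace E := FiniteDimensional.complete ℝ E
  obtain ⟨r, hr, hrU⟩ := Metric.isOpen_iff.mp hU x₀ hx₀
  -- The cut-off field is smooth on all of `E`. The solutions found below stay in the ball of radius
  -- `r / 3`, where `χ = 1`, so they are integral curves for `f` itself.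
  let χ : ContDiffBump x₀ := ⟨r / 3, r / 2, by positivity, by linarith⟩
  have hχ : tsupport χ ⊆ U := by
    rw [χ.tsupport_eq]
    exact (Metric.closedBall_subset_ball (by simp [χ]; linarith)).trans hrU
  have hg : ContDiff ℝ ∞ (fun x => χ x • f x) := by
    rw [contDiff_iff_contDiffAt]
    intro x
    by_cases hx : x ∈ tsupport χ
    · exact χ.contDiffAt.smul (hf.contDiffAt (hU.mem_nhds (hχ hx)))
    · refine (contDiffAt_const (c := (0 : E))).congr_of_eventuallyEq ?_
      filter_upwards [(isClosed_tsupport χ).isOpen_compl.mem_nhds hx] with y hy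
      rw [image_eq_zero_of_notMem_tsupport hy, zero_smul]
  obtain ⟨c, hc, hc0, hce⟩ := exists_flow_of_contDiff hg x₀
  have h01 : (-1 : ℝ) ≤ 1 := by norm_num
  refine ⟨fun p => IccExtend h01 (c p), ?_, ?_⟩
  -- Evaluation at a fixed time is a bounded linear map on curves. The time `1 / 2` is interior to
  -- `(-1, 1)`, where uniqueness of integral curves can be applied later.
  · exact ((ContinuousMap.evalCLM ℝ (projIcc (-1 : ℝ) 1 h01 (1 / 2))).contDiff.contDiffAt).comp
      (0, x₀) hc
  · have hnear : ∀ᶠ p in 𝓝 ((0 : ℝ), x₀), dist (c p) (c (0, x₀)) < r / 3 :=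
      hc.continuousAt.tendsto (Metric.ball_mem_nhds _ (by positivity))
    filter_upwards [hce, hnear] with p hp hpd
    have hball : ∀ t, IccExtend h01 (c p) t ∈ Metric.ball x₀ (r / 3) := fun t => by
      have := (ContinuousMap.dist_apply_le_dist (f := c p) (g := c (0, x₀))
        (projIcc (-1 : ℝ) 1 h01 t)).trans_lt hpd
      rw [hc0] at this
      exact this
    have hcont : Continuous (IccExtend h01 (c p)) := (c p).continuous.Icc_extend'
    refine ⟨?_, fun t ht => ⟨hrU (Metric.ball_subset_ball (by linarith) (hball t)), ?_⟩⟩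
    · rw [IccExtend_of_mem h01 (c p) (by norm_num : (0 : ℝ) ∈ Icc (-1) 1), hp]
      simp
    · have h1 : HasDerivAt (fun t : ℝ => p.2 + p.1 • ∫ τ in (0 : ℝ)..t,
          (χ (IccExtend h01 (c p) τ) • f (IccExtend h01 (c p) τ)))
          (p.1 • (χ (IccExtend h01 (c p) t) • f (IccExtend h01 (c p) t))) t := by
        refine ((intervalIntegral.integral_hasDerivAt_right ?_ ?_ ?_).const_smul _).const_add _
        · exact (hg.continuous.comp hcont).intervalIntegrable _ _
        · exact (hg.continuous.comp hcont).stronglyMeasurableAtFilter _ _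
        · exact (hg.continuous.comp hcont).continuousAt
      rw [χ.one_of_mem_closedBall (Metric.ball_subset_closedBall (hball t)), one_smul] at h1
      refine h1.congr_of_eventuallyEq ?_
      filter_upwards [Ioo_mem_nhds ht.1 ht.2] with s hs
      rw [IccExtend_of_mem h01 (c p) ⟨hs.1.le, hs.2.le⟩, hp]

end LocalFlow

/-! ### Differentials of charts and vector fields in coordinates. -/

section Charts

variable {E : Type*} [NormedAddCommGroup E] [NormedSpace ℝ E]
  {M : Type*} [TopologicalSpace M] [ChartedSpace E M]

theorem mdifferentiableAt_chart_symm [IsManifold 𝓘(ℝ, E) 1 M] {x : M} {y : E}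
    (hy : y ∈ (extChartAt 𝓘(ℝ, E) x).target) :
    MDifferentiableAt 𝓘(ℝ, E) 𝓘(ℝ, E) (extChartAt 𝓘(ℝ, E) x).symm y :=
  (mdifferentiableOn_extChartAt_symm y hy).mdifferentiableAt (extChartAt_target_mem_nhds' hy)

theorem mdifferentiableAt_chart [IsManifold 𝓘(ℝ, E) 1 M] {x z : M}
    (hz : z ∈ (extChartAt 𝓘(ℝ, E) x).source) :
    MDifferentiableAt 𝓘(ℝ, E) 𝓘(ℝ, E) (extChartAt 𝓘(ℝ, E) x) z :=
  mdifferentiableAt_extChartAt (by rwa [extChartAt_source] at hz)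

theorem mfderiv_chart_mfderiv_symm [IsManifold 𝓘(ℝ, E) 1 M] {x : M} {y : E}
    (hy : y ∈ (extChartAt 𝓘(ℝ, E) x).target) (u : E) :
    mfderiv 𝓘(ℝ, E) 𝓘(ℝ, E) (extChartAt 𝓘(ℝ, E) x) ((extChartAt 𝓘(ℝ, E) x).symm y)
      (mfderiv 𝓘(ℝ, E) 𝓘(ℝ, E) (extChartAt 𝓘(ℝ, E) x).symm y u) = u := by
  have h := mfderiv_extChartAt_comp_mfderivWithin_extChartAt_symm (I := 𝓘(ℝ, E)) hy
  rw [modelWithCornersSelf_coe, range_id, mfderivWithin_univ] at h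
  exact congrArg (fun f : E →L[ℝ] E => f u) h

theorem mfderiv_symm_mfderiv_chart [IsManifold 𝓘(ℝ, E) 1 M] {x : M} {y : E}
    (hy : y ∈ (extChartAt 𝓘(ℝ, E) x).target)
    (u : TangentSpace 𝓘(ℝ, E) ((extChartAt 𝓘(ℝ, E) x).symm y)) :
    mfderiv 𝓘(ℝ, E) 𝓘(ℝ, E) (extChartAt 𝓘(ℝ, E) x).symm y
      (mfderiv 𝓘(ℝ, E) 𝓘(ℝ, E) (extChartAt 𝓘(ℝ, E) x) ((extChartAt 𝓘(ℝ, E) x).symm y) u) = u := by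
  have h := mfderivWithin_extChartAt_symm_comp_mfderiv_extChartAt (I := 𝓘(ℝ, E)) hy
  rw [modelWithCornersSelf_coe, range_id, mfderivWithin_univ] at h
  exact congrArg (fun f : E →L[ℝ] E => f u) h

/-- The coordinate expression of a vector field in the preferred chart at `x`. -/
noncomputable def fieldInChart (v : ∀ x : M, TangentSpace 𝓘(ℝ, E) x) (x : M) (y : E) : E :=
  mfderiv 𝓘(ℝ, E) 𝓘(ℝ, E) (extChartAt 𝓘(ℝ, E) x) ((extChartAt 𝓘(ℝ, E) x).symm y)
    (v ((extChartAt 𝓘(ℝ, E) x).symm y))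

theorem mfderiv_symm_fieldInChart [IsManifold 𝓘(ℝ, E) 1 M]
    (v : ∀ x : M, TangentSpace 𝓘(ℝ, E) x) {x : M} {y : E}
    (hy : y ∈ (extChartAt 𝓘(ℝ, E) x).target) :
    mfderiv 𝓘(ℝ, E) 𝓘(ℝ, E) (extChartAt 𝓘(ℝ, E) x).symm y (fieldInChart (E := E) v x y) =
      v ((extChartAt 𝓘(ℝ, E) x).symm y) :=
  mfderiv_symm_mfderiv_chart hy _

theorem contMDiff_iff_fieldInChart [IsManifold 𝓘(ℝ, E) ∞ M]
    (v : ∀ x : M, TangentSpace 𝓘(ℝ, E) x) :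
    ContMDiff 𝓘(ℝ, E) 𝓘(ℝ, E).tangent ∞ (fun x => (⟨x, v x⟩ : TangentBundle 𝓘(ℝ, E) M)) ↔
      ∀ x₀, ContDiffOn ℝ ∞ (fieldInChart v x₀) (extChartAt 𝓘(ℝ, E) x₀).target := by
  -- In the tangent bundle, the fibre coordinate of the trivialization at `x₀` is the differential
  -- of the chart at `x₀`.
  have key : ∀ x₀ x : M, x ∈ (extChartAt 𝓘(ℝ, E) x₀).source →
      ((trivializationAt E (TangentSpace 𝓘(ℝ, E)) x₀) ⟨x, v x⟩).2 =
        fieldInChart v x₀ (extChartAt 𝓘(ℝ, E) x₀ x) := by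
    intro x₀ x hx
    rw [fieldInChart, (extChartAt 𝓘(ℝ, E) x₀).left_inv hx]
    rw [extChartAt_source] at hx
    have h := TangentBundle.continuousLinearMapAt_trivializationAt (I := 𝓘(ℝ, E)) hx
    have h2 := congrArg (fun f : TangentSpace 𝓘(ℝ, E) x →L[ℝ] E => f (v x)) h
    refine Eq.trans ?_ h2
    refine (((trivializationAt E (TangentSpace 𝓘(ℝ, E)) x₀).coe_linearMapAt_of_mem
      (R := ℝ) (b := x) (by simpa using hx)).symm ▸ rfl)
  constructor
  · intro h x₀
    rw [← contMDiffOn_iff_contDiffOn]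
    have h1 : ContMDiffOn 𝓘(ℝ, E) 𝓘(ℝ, E) ∞
        (fun x => ((trivializationAt E (TangentSpace 𝓘(ℝ, E)) x₀) ⟨x, v x⟩).2)
        (extChartAt 𝓘(ℝ, E) x₀).source := by
      refine ((trivializationAt E (TangentSpace 𝓘(ℝ, E)) x₀).contMDiffOn_section_iff
        (isOpen_extChartAt_source x₀) ?_).mp h.contMDiffOn
      intro x hx
      rw [extChartAt_source] at hx
      simpa using hx
    refine (h1.comp (contMDiffOn_extChartAt_symm x₀)
      (extChartAt 𝓘(ℝ, E) x₀).mapsTo_symm).congr fun y hy => ?_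
    rw [Function.comp_apply, key x₀ _ ((extChartAt 𝓘(ℝ, E) x₀).map_target hy),
      (extChartAt 𝓘(ℝ, E) x₀).right_inv hy]
  · intro h x₀
    refine ((trivializationAt E (TangentSpace 𝓘(ℝ, E)) x₀).contMDiffAt_section_iff
      (FiberBundle.mem_baseSet_trivializationAt' x₀)).mpr ?_
    have h1 : ContMDiffAt 𝓘(ℝ, E) 𝓘(ℝ, E) ∞
        (fun x => fieldInChart v x₀ (extChartAt 𝓘(ℝ, E) x₀ x)) x₀ :=
      ((h x₀).contDiffAt (extChartAt_target_mem_nhds x₀)).contMDiffAt.comp x₀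
        contMDiffAt_extChartAt
    refine h1.congr_of_eventuallyEq ?_
    filter_upwards [extChartAt_source_mem_nhds (I := 𝓘(ℝ, E)) x₀] with x hx using key x₀ x hx

end Charts

/-! ### Flows of vector fields on compact manifolds. -/

section Flow

variable {E : Type*} [NormedAddCommGroup E] [NormedSpace ℝ E] [FiniteDimensional ℝ E]
  {M : Type*} [TopologicalSpace M] [ChartedSpace E M] [IsManifold 𝓘(ℝ, E) ∞ M]
  {v : ∀ x : M, TangentSpace 𝓘(ℝ, E) x}

/-- Local flow of a smooth vector field on a manifold, with time rescaled. -/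
theorem exists_local_flow_manifold
    (hv : ContMDiff 𝓘(ℝ, E) 𝓘(ℝ, E).tangent ∞ (fun x => (⟨x, v x⟩ : TangentBundle 𝓘(ℝ, E) M)))
    (x₀ : M) :
    ∃ c : ℝ × M → ℝ → M,
      ContMDiffAt (𝓘(ℝ, ℝ).prod 𝓘(ℝ, E)) 𝓘(ℝ, E) ∞ (fun p => c p (1 / 2)) (0, x₀) ∧
      ∀ᶠ p in 𝓝 ((0 : ℝ), x₀), c p 0 = p.2 ∧
        IsMIntegralCurveOn (I := 𝓘(ℝ, E)) (c p) (p.1 • v) (Ioo (-1 : ℝ) 1) := by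
  have : IsManifold 𝓘(ℝ, E) 1 M := IsManifold.of_le (n := ∞) (by simp)
  set ψ := extChartAt 𝓘(ℝ, E) x₀ with hψ
  obtain ⟨c, hc, hce⟩ := exists_local_flow (isOpen_extChartAt_target x₀)
    ((contMDiff_iff_fieldInChart v).mp hv x₀) (mem_extChartAt_target (I := 𝓘(ℝ, E)) x₀)
  have hpair : ContMDiffAt (𝓘(ℝ, ℝ).prod 𝓘(ℝ, E)) 𝓘(ℝ, ℝ × E) ∞
      (fun p : ℝ × M => (p.1, ψ p.2)) (0, x₀) :=
    contMDiffAt_fst.prodMk_space (contMDiffAt_extChartAt.comp (0, x₀) contMDiffAt_snd)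
  have hce' : ∀ᶠ p in 𝓝 ((0 : ℝ), x₀), _ := hpair.continuousAt.eventually hce
  have h0 := (hce'.self_of_nhds).2 (1 / 2) (by norm_num)
  refine ⟨fun p t => ψ.symm (c (p.1, ψ p.2) t), ?_, ?_⟩
  · have hs : ContMDiffAt 𝓘(ℝ, E) 𝓘(ℝ, E) ∞ ψ.symm (c (0, ψ x₀) (1 / 2)) :=
      (contMDiffOn_extChartAt_symm x₀ _ h0.1).contMDiffAt (extChartAt_target_mem_nhds' h0.1)
    have hm := ContMDiffAt.comp (0, x₀) (f := fun p : ℝ × M => (p.1, ψ p.2))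
      (g := fun p => c p (1 / 2)) (I' := 𝓘(ℝ, ℝ × E)) hc.contMDiffAt hpair
    exact ContMDiffAt.comp (0, x₀) (g := ψ.symm) hs hm
  · have hsrc : ∀ᶠ p in 𝓝 ((0 : ℝ), x₀), p.2 ∈ ψ.source :=
      continuousAt_snd.eventually (extChartAt_source_mem_nhds (I := 𝓘(ℝ, E)) x₀)
    filter_upwards [hce', hsrc] with p hp hps
    refine ⟨?_, fun t ht => ?_⟩
    · rw [hp.1, ψ.left_inv hps]
    · obtain ⟨h1, h2⟩ := hp.2 t ht
      have h3 := (mdifferentiableAt_chart_symm h1).hasMFDerivAt.comp t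
        h2.hasFDerivAt.hasMFDerivAt
      refine (h3.congr_mfderiv (f' := (_ : ℝ →L[ℝ] E)) ?_).hasMFDerivWithinAt
      refine ContinuousLinearMap.ext_ring (R₁ := ℝ) (M₁ := E) ?_
      have h4 := mfderiv_symm_fieldInChart v h1
      have h5 := congrArg (fun w : E => p.1 • w) h4
      have h6 := map_smul (mfderiv 𝓘(ℝ, E) 𝓘(ℝ, E) ψ.symm (c (p.1, ψ p.2) t)) p.1
        (fieldInChart (E := E) v x₀ (c (p.1, ψ p.2) t))
      change (mfderiv 𝓘(ℝ, E) 𝓘(ℝ, E) ψ.symm (c (p.1, ψ p.2) t))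
        ((1 : ℝ) • p.1 • fieldInChart (E := E) v x₀ (c (p.1, ψ p.2) t)) = (1 : ℝ) • (p.1 • v _)
      rw [one_smul, one_smul]
      exact h6.trans h5

end Flow

section Flow

variable {E : Type*} [NormedAddCommGroup E] [NormedSpace ℝ E] [FiniteDimensional ℝ E]
  {M : Type*} [TopologicalSpace M] [T2Space M] [CompactSpace M] [ChartedSpace E M]
  [IsManifold 𝓘(ℝ, E) ∞ M] {v : ∀ x : M, TangentSpace 𝓘(ℝ, E) x}

/-- On a compact manifold, every smooth vector field has global integral curves. -/
theorem exists_isMIntegralCurve_of_compact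
    (hv : ContMDiff 𝓘(ℝ, E) 𝓘(ℝ, E).tangent ∞ (fun x => (⟨x, v x⟩ : TangentBundle 𝓘(ℝ, E) M)))
    (x : M) : ∃ γ : ℝ → M, γ 0 = x ∧ IsMIntegralCurve (I := 𝓘(ℝ, E)) γ v := by
  have : IsManifold 𝓘(ℝ, E) 1 M := IsManifold.of_le (n := ∞) (by simp)
  -- Compactness gives one `s > 0` that works at all starting points, hence a common existence
  -- interval `(-s, s)`, which suffices to continue solutions for all time.
  have hloc : ∀ᶠ s in 𝓝 (0 : ℝ), ∀ y ∈ (univ : Set M), ∃ γ : ℝ → M, γ 0 = y ∧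
      IsMIntegralCurveOn (I := 𝓘(ℝ, E)) γ (s • v) (Ioo (-1 : ℝ) 1) := by
    refine isCompact_univ.eventually_forall_of_forall_eventually fun x₀ _ => ?_
    obtain ⟨c, -, hc⟩ := exists_local_flow_manifold hv x₀
    exact hc.mono fun p hp => ⟨c p, hp⟩
  obtain ⟨s, hs, hs0⟩ := ((hloc.filter_mono nhdsWithin_le_nhds).and
    (self_mem_nhdsWithin (s := Ioi (0 : ℝ)))).exists
  have hs0 : 0 < s := hs0
  refine exists_isMIntegralCurve_of_isMIntegralCurveOn (hv.of_le (by simp)) hs0 (fun y => ?_) x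
  obtain ⟨γ, hγ0, hγ⟩ := hs y (mem_univ y)
  refine ⟨γ ∘ (· * s⁻¹), by simp [hγ0], ?_⟩
  have h := hγ.comp_mul s⁻¹
  rw [smul_smul, inv_mul_cancel₀ hs0.ne', one_smul] at h
  refine h.mono fun t ht => ?_
  rw [mem_ofPred_eq, ← div_eq_mul_inv, mem_Ioo, lt_div_iff₀ hs0, div_lt_iff₀ hs0]
  simpa using ht

/-- The flow of a smooth vector field on a compact manifold. -/
theorem exists_flow
    (hv : ContMDiff 𝓘(ℝ, E) 𝓘(ℝ, E).tangent ∞ (fun x => (⟨x, v x⟩ : TangentBundle 𝓘(ℝ, E) M))) :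
    ∃ φ : ℝ → M → M, (∀ x, φ 0 x = x) ∧ (∀ s t x, φ (s + t) x = φ s (φ t x)) ∧
      (∀ x, IsMIntegralCurve (I := 𝓘(ℝ, E)) (fun t => φ t x) v) ∧
      ContMDiff (𝓘(ℝ, ℝ).prod 𝓘(ℝ, E)) 𝓘(ℝ, E) ∞ (fun p : ℝ × M => φ p.1 p.2) := by
  have : IsManifold 𝓘(ℝ, E) 1 M := IsManifold.of_le (n := ∞) (by simp)
  have hv1 : ContMDiff 𝓘(ℝ, E) 𝓘(ℝ, E).tangent 1
    (fun x => (⟨x, v x⟩ : TangentBundle 𝓘(ℝ, E) M)) := hv.of_le (by simp)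
  choose γ hγ0 hγ using exists_isMIntegralCurve_of_compact hv
  have hadd : ∀ s t x, γ x (s + t) = γ (γ x t) s := fun s t x =>
    congrFun (isMIntegralCurve_Ioo_eq_of_contMDiff_boundaryless (t₀ := 0) hv1 ((hγ x).comp_add t)
      (hγ (γ x t)) (by simp [hγ0])) s
  set Φ : ℝ × M → M := fun p => γ p.2 p.1 with hΦ
  have hzero : ∀ x₀, ContMDiffAt (𝓘(ℝ, ℝ).prod 𝓘(ℝ, E)) 𝓘(ℝ, E) ∞ Φ (0, x₀) := by
    intro x₀
    obtain ⟨c, hc, hce⟩ := exists_local_flow_manifold hv x₀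
    have h1 : ContMDiffAt (𝓘(ℝ, ℝ).prod 𝓘(ℝ, E)) 𝓘(ℝ, E) ∞
        (fun p : ℝ × M => γ p.2 (1 / 2 * p.1)) (0, x₀) := by
      refine hc.congr_of_eventuallyEq (hce.mono fun p hp => ?_)
      -- Uniqueness identifies the rescaled global curve with the local one, so the flow inherits
      -- smoothness near time `0`. The map `h2` below undoes the factor `1 / 2`.
      have hsv : ContMDiff 𝓘(ℝ, E) 𝓘(ℝ, E).tangent 1
          (fun x => (⟨x, (p.1 • v) x⟩ : TangentBundle 𝓘(ℝ, E) M)) := hv1.const_smul_section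
      exact isMIntegralCurveOn_Ioo_eqOn_of_contMDiff_boundaryless (t₀ := 0) (by norm_num) hsv
        (((hγ p.2).comp_mul p.1).isMIntegralCurveOn _) hp.2 (by simp [hγ0, hp.1])
        (by norm_num : (1 / 2 : ℝ) ∈ Ioo (-1 : ℝ) 1)
    have h2 : ContMDiff (𝓘(ℝ, ℝ).prod 𝓘(ℝ, E)) (𝓘(ℝ, ℝ).prod 𝓘(ℝ, E)) ∞
        (fun p : ℝ × M => (2 * p.1, p.2)) :=
      ((contDiff_const.mul contDiff_id : ContDiff ℝ ∞ fun t : ℝ => 2 * t).contMDiff.comp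
        contMDiff_fst).prodMk contMDiff_snd
    have h3 := ContMDiffAt.comp_of_eq (y := ((0 : ℝ), x₀)) (x := ((0 : ℝ), x₀)) h1
      h2.contMDiffAt (by simp)
    refine h3.congr_of_eventuallyEq (Eventually.of_forall fun p => ?_)
    simp [Φ]
  refine ⟨fun t x => γ x t, hγ0, hadd, hγ, ?_⟩
  -- Being `C^n` at a point spreads to a neighbourhood only for finite `n`, and `hunif` needs this
  -- spreading.
  rw [contMDiff_infty]
  intro n
  have hunif : ∀ᶠ s in 𝓝 (0 : ℝ), ∀ x ∈ (univ : Set M),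
      ContMDiffAt (𝓘(ℝ, ℝ).prod 𝓘(ℝ, E)) 𝓘(ℝ, E) n Φ (s, x) := by
    refine isCompact_univ.eventually_forall_of_forall_eventually fun x₀ _ => ?_
    have : IsManifold 𝓘(ℝ, E) n M := IsManifold.of_le (n := ∞) (by exact_mod_cast le_top)
    have h : ContMDiffAt (𝓘(ℝ, ℝ).prod 𝓘(ℝ, E)) 𝓘(ℝ, E) n Φ (0, x₀) :=
      (hzero x₀).of_le (by exact_mod_cast le_top)
    exact (contMDiffAt_iff_contMDiffAt_nhds (by simp)).mp h
  obtain ⟨ε, hε, hε'⟩ := Metric.eventually_nhds_iff.mp hunif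
  have hslice : ∀ s, |s| < ε → ContMDiff 𝓘(ℝ, E) 𝓘(ℝ, E) n (fun x => γ x s) := fun s hs x =>
    (hε' (by simpa using hs) x (mem_univ x)).comp x
      (contMDiffAt_const.prodMk contMDiffAt_id)
  -- A time-`t` map is an iterate of the map for the small time `t / N`, hence `C^n`.
  have hmul : ∀ s, |s| < ε → ∀ N : ℕ, ContMDiff 𝓘(ℝ, E) 𝓘(ℝ, E) n (fun x => γ x (N * s)) := by
    intro s hs N
    induction N with
    | zero => simpa [hγ0] using! contMDiff_id
    | succ N ih =>
      have : (fun x => γ x ((N + 1 : ℕ) * s)) = (fun x => γ x s) ∘ (fun x => γ x (N * s)) := by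
        funext x
        rw [Function.comp_apply, ← hadd]
        congr 1
        push_cast
        ring
      rw [this]
      exact (hslice s hs).comp ih
  have hall : ∀ t, ContMDiff 𝓘(ℝ, E) 𝓘(ℝ, E) n (fun x => γ x t) := by
    intro t
    obtain ⟨N, hN⟩ := exists_nat_gt (|t| / ε)
    have hN0 : (0 : ℝ) < N := (by positivity : 0 ≤ |t| / ε).trans_lt hN
    have h := hmul (t / N) (by
      rw [abs_div, abs_of_pos hN0, div_lt_iff₀ hN0]
      rwa [div_lt_iff₀ hε, mul_comm] at hN) N
    rwa [mul_div_cancel₀ _ hN0.ne'] at h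
  rintro ⟨t₀, x₀⟩
  -- Near time `t₀` the flow is the time-`t₀` map followed by the flow for time `t - t₀`, which is
  -- close to `0`.
  have h1 : ContMDiffAt (𝓘(ℝ, ℝ).prod 𝓘(ℝ, E)) (𝓘(ℝ, ℝ).prod 𝓘(ℝ, E)) n
      (fun p : ℝ × M => (p.1 - t₀, γ p.2 t₀)) (t₀, x₀) :=
    (((contDiff_id.sub contDiff_const : ContDiff ℝ n fun t : ℝ => t - t₀).contMDiff.comp
      contMDiff_fst).prodMk ((hall t₀).comp contMDiff_snd)).contMDiffAt
  have h2 := ContMDiffAt.comp_of_eq (y := ((0 : ℝ), γ x₀ t₀)) (x := (t₀, x₀))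
    ((hzero (γ x₀ t₀)).of_le (by exact_mod_cast le_top)) h1 (by simp)
  refine h2.congr_of_eventuallyEq (Eventually.of_forall fun p => ?_)
  simp [Φ, ← hadd]

end Flow

/-! ### Contact forms and contact vector fields in coordinates. -/

section Forms

variable {E : Type*} [NormedAddCommGroup E] [NormedSpace ℝ E]
  {V : Type*} [TopologicalSpace V] [ChartedSpace E V]

theorem formInChart_apply (a : ∀ x : V, TangentSpace 𝓘(ℝ, E) x →L[ℝ] ℝ) (x : V) (y u : E) :
    formInChart a x y u = a ((extChartAt 𝓘(ℝ, E) x).symm y)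
      (mfderiv 𝓘(ℝ, E) 𝓘(ℝ, E) (extChartAt 𝓘(ℝ, E) x).symm y u) := rfl

variable [IsManifold 𝓘(ℝ, E) ∞ V]

theorem formInChart_mfderiv_chart
    (a : ∀ x : V, TangentSpace 𝓘(ℝ, E) x →L[ℝ] ℝ) {x : V}
    {y : E} (hy : y ∈ (extChartAt 𝓘(ℝ, E) x).target)
    (u : TangentSpace 𝓘(ℝ, E) ((extChartAt 𝓘(ℝ, E) x).symm y)) :
    formInChart a x y (mfderiv 𝓘(ℝ, E) 𝓘(ℝ, E) (extChartAt 𝓘(ℝ, E) x)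
      ((extChartAt 𝓘(ℝ, E) x).symm y) u) = a _ u := by
  exact (formInChart_apply a x y _).trans (congrArg _ (mfderiv_symm_mfderiv_chart hy u))

/-- A smooth 1-form has smooth coordinate expressions. -/
theorem contDiffOn_formInChart {a : ∀ x : V, TangentSpace 𝓘(ℝ, E) x →L[ℝ] ℝ}
    (ha : ContMDiff 𝓘(ℝ, E) (𝓘(ℝ, E).prod 𝓘(ℝ, E →L[ℝ] ℝ)) ∞
      (fun x => Bundle.TotalSpace.mk' (E →L[ℝ] ℝ)
        (E := fun x : V => TangentSpace 𝓘(ℝ, E) x →L[ℝ] ℝ) x (a x))) (x₀ : V) :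
    ContDiffOn ℝ ∞ (formInChart a x₀) (extChartAt 𝓘(ℝ, E) x₀).target := by
  rw [← contMDiffOn_iff_contDiffOn]
  let e := trivializationAt (E →L[ℝ] ℝ) (fun x : V => TangentSpace 𝓘(ℝ, E) x →L[ℝ] ℝ) x₀
  have h1 : ContMDiffOn 𝓘(ℝ, E) 𝓘(ℝ, E →L[ℝ] ℝ) ∞ (fun x => (e ⟨x, a x⟩).2)
      (extChartAt 𝓘(ℝ, E) x₀).source := by
    refine (e.contMDiffOn_section_iff (isOpen_extChartAt_source x₀) ?_).mp ha.contMDiffOn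
    intro x hx
    rw [extChartAt_source] at hx
    exact ⟨by simpa using hx, mem_univ _⟩
  refine (h1.comp (contMDiffOn_extChartAt_symm x₀)
    (extChartAt 𝓘(ℝ, E) x₀).mapsTo_symm).congr fun y hy => ?_
  have hx : (extChartAt 𝓘(ℝ, E) x₀).symm y ∈ (chartAt E x₀).source := by
    rw [← extChartAt_source 𝓘(ℝ, E)]
    exact (extChartAt 𝓘(ℝ, E) x₀).map_target hy
  have h2 := TangentBundle.symmL_trivializationAt (I := 𝓘(ℝ, E)) hx
  rw [(extChartAt 𝓘(ℝ, E) x₀).right_inv hy, modelWithCornersSelf_coe, range_id,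
    mfderivWithin_univ] at h2
  refine ContinuousLinearMap.ext fun u => ?_
  rw [formInChart_apply]
  -- The cotangent trivialization is precomposition with the inverse of the tangent one, which `h2`
  -- identifies with the differential of the inverse chart.
  have h3 : (e ⟨(extChartAt 𝓘(ℝ, E) x₀).symm y, a ((extChartAt 𝓘(ℝ, E) x₀).symm y)⟩).2 u =
      a ((extChartAt 𝓘(ℝ, E) x₀).symm y)
        ((trivializationAt E (TangentSpace 𝓘(ℝ, E)) x₀).symmL ℝ
          ((extChartAt 𝓘(ℝ, E) x₀).symm y) u) := by
    change ContinuousLinearMap.inCoordinates E (TangentSpace 𝓘(ℝ, E)) ℝ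
      (Bundle.Trivial V ℝ) x₀ ((extChartAt 𝓘(ℝ, E) x₀).symm y) x₀
      ((extChartAt 𝓘(ℝ, E) x₀).symm y) (a ((extChartAt 𝓘(ℝ, E) x₀).symm y)) u = _
    rw [ContinuousLinearMap.inCoordinates]
    simp
    rfl
  refine Eq.trans ?_ h3.symm
  exact congrArg (fun f : E →L[ℝ] E => a ((extChartAt 𝓘(ℝ, E) x₀).symm y) (f u)) h2.symm

/-- Naturality of the exterior derivative of a 1-form on a vector space: if `B = τ^* A`, then
`dB = τ^* dA`. -/
theorem extDeriv_pullback {A B : E → E →L[ℝ] ℝ} {τ : E → E} {z : E}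
    (hA : DifferentiableAt ℝ A (τ z)) (hτ : ContDiffAt ℝ 2 τ z)
    (hB : B =ᶠ[𝓝 z] fun z' => (A (τ z')).comp (fderiv ℝ τ z')) (u v : E) :
    fderiv ℝ B z u v - fderiv ℝ B z v u =
      fderiv ℝ A (τ z) (fderiv ℝ τ z u) (fderiv ℝ τ z v) -
        fderiv ℝ A (τ z) (fderiv ℝ τ z v) (fderiv ℝ τ z u) := by
  have hd : DifferentiableAt ℝ (fderiv ℝ τ) z :=
    (hτ.fderiv_right (m := 1) (by norm_num)).differentiableAt (by norm_num)
  have h1 : HasFDerivAt (fun z' => A (τ z')) ((fderiv ℝ A (τ z)).comp (fderiv ℝ τ z)) z :=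
    hA.hasFDerivAt.comp z (hτ.differentiableAt (by norm_num)).hasFDerivAt
  have h2 := (h1.clm_comp hd.hasFDerivAt).congr_of_eventuallyEq hB
  -- The terms with the second derivative of `τ` are symmetric, so they cancel on antisymmetrizing.
  have hsymm := hτ.isSymmSndFDerivAt (by simp)
  rw [h2.fderiv]
  simp [hsymm.eq u v]

end Forms

section Forms

variable {E : Type*} [NormedAddCommGroup E] [NormedSpace ℝ E]
  {V : Type*} [TopologicalSpace V] [ChartedSpace E V] [IsManifold 𝓘(ℝ, E) ∞ V]

theorem two_le_infty : (2 : WithTop ℕ∞) ≤ ∞ :=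
  WithTop.coe_le_coe.mpr (le_top : (2 : ℕ∞) ≤ ⊤)

/-- Change of charts for the coordinate expressions of a 1-form. -/
theorem formInChart_eventuallyEq (a : ∀ x : V, TangentSpace 𝓘(ℝ, E) x →L[ℝ] ℝ) (x₀ x : V)
    (hx : x ∈ (extChartAt 𝓘(ℝ, E) x₀).source) :
    formInChart a x =ᶠ[𝓝 (extChartAt 𝓘(ℝ, E) x x)] fun z =>
      (formInChart a x₀ ((extChartAt 𝓘(ℝ, E) x₀) ((extChartAt 𝓘(ℝ, E) x).symm z))).comp
        (fderiv ℝ (fun z => (extChartAt 𝓘(ℝ, E) x₀) ((extChartAt 𝓘(ℝ, E) x).symm z)) z) := by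
  set ψ := extChartAt 𝓘(ℝ, E) x₀ with hψ
  set κ := extChartAt 𝓘(ℝ, E) x with hκ
  have hκx : κ.symm (κ x) = x := κ.left_inv (mem_extChartAt_source x)
  have h1 : ∀ᶠ z in 𝓝 (κ x), z ∈ κ.target := extChartAt_target_mem_nhds x
  have h2 : ∀ᶠ z in 𝓝 (κ x), κ.symm z ∈ ψ.source :=
    (continuousAt_extChartAt_symm x).eventually
      (by rw [← hκ, hκx]; exact (isOpen_extChartAt_source x₀).mem_nhds hx)
  filter_upwards [h1.and h2 |>.eventually_nhds, h1, h2] with z hz hz1 hz2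
  refine ContinuousLinearMap.ext fun u => ?_
  have hcomp : mfderiv 𝓘(ℝ, E) 𝓘(ℝ, E) (fun z => ψ (κ.symm z)) z =
      (mfderiv 𝓘(ℝ, E) 𝓘(ℝ, E) ψ (κ.symm z)).comp (mfderiv 𝓘(ℝ, E) 𝓘(ℝ, E) κ.symm z) :=
    mfderiv_comp z (mdifferentiableAt_chart hz2) (mdifferentiableAt_chart_symm hz1)
  rw [mfderiv_eq_fderiv] at hcomp
  have hτ : ψ (κ.symm z) ∈ ψ.target := ψ.map_source hz2
  have hback : ψ.symm (ψ (κ.symm z)) = κ.symm z := ψ.left_inv hz2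
  have h3 := formInChart_mfderiv_chart a hτ
  rw [← hψ, hback] at h3
  have h4 := h3 (mfderiv 𝓘(ℝ, E) 𝓘(ℝ, E) κ.symm z u)
  rw [ContinuousLinearMap.comp_apply, hcomp]
  exact h4.symm

/-- The exterior derivative of a smooth 1-form can be computed in any chart. -/
theorem dForm_chart {a : ∀ x : V, TangentSpace 𝓘(ℝ, E) x →L[ℝ] ℝ} {x₀ : V}
    (ha : ContDiffOn ℝ ∞ (formInChart a x₀) (extChartAt 𝓘(ℝ, E) x₀).target) {x : V}
    (hx : x ∈ (extChartAt 𝓘(ℝ, E) x₀).source) (u v : TangentSpace 𝓘(ℝ, E) x) :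
    dForm a x u v =
      fderiv ℝ (formInChart a x₀) (extChartAt 𝓘(ℝ, E) x₀ x)
        (mfderiv 𝓘(ℝ, E) 𝓘(ℝ, E) (extChartAt 𝓘(ℝ, E) x₀) x u : E)
        (mfderiv 𝓘(ℝ, E) 𝓘(ℝ, E) (extChartAt 𝓘(ℝ, E) x₀) x v : E) -
      fderiv ℝ (formInChart a x₀) (extChartAt 𝓘(ℝ, E) x₀ x)
        (mfderiv 𝓘(ℝ, E) 𝓘(ℝ, E) (extChartAt 𝓘(ℝ, E) x₀) x v : E)
        (mfderiv 𝓘(ℝ, E) 𝓘(ℝ, E) (extChartAt 𝓘(ℝ, E) x₀) x u : E) := by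
  set ψ := extChartAt 𝓘(ℝ, E) x₀ with hψ
  set κ := extChartAt 𝓘(ℝ, E) x with hκ
  have hκx : κ.symm (κ x) = x := κ.left_inv (mem_extChartAt_source x)
  have hxt : κ x ∈ κ.target := mem_extChartAt_target x
  have hτx : ψ (κ.symm (κ x)) = ψ x := by rw [hκx]
  have hτ : ContDiffAt ℝ 2 (fun z => ψ (κ.symm z)) (κ x) := by
    rw [← contMDiffAt_iff_contDiffAt]
    have h1 : ContMDiffAt 𝓘(ℝ, E) 𝓘(ℝ, E) ∞ κ.symm (κ x) :=
      (contMDiffOn_extChartAt_symm x _ hxt).contMDiffAt (extChartAt_target_mem_nhds x)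
    have h2 : ContMDiffAt 𝓘(ℝ, E) 𝓘(ℝ, E) ∞ ψ (κ.symm (κ x)) := by
      rw [hκx]
      exact contMDiffAt_extChartAt' (by rwa [hψ, extChartAt_source] at hx)
    exact (h2.comp _ h1).of_le two_le_infty
  have hA : DifferentiableAt ℝ (formInChart a x₀) (ψ (κ.symm (κ x))) := by
    rw [hτx]
    exact (ha.contDiffAt (extChartAt_target_mem_nhds' (ψ.map_source hx))).differentiableAt
      (by simp)
  have hT : ∀ w : TangentSpace 𝓘(ℝ, E) x, fderiv ℝ (fun z => ψ (κ.symm z)) (κ x)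
      (mfderiv 𝓘(ℝ, E) 𝓘(ℝ, E) κ x w : E) = mfderiv 𝓘(ℝ, E) 𝓘(ℝ, E) ψ x w := by
    intro w
    have hcomp : mfderiv 𝓘(ℝ, E) 𝓘(ℝ, E) (fun z => ψ (κ.symm z)) (κ x) =
        (mfderiv 𝓘(ℝ, E) 𝓘(ℝ, E) ψ (κ.symm (κ x))).comp
          (mfderiv 𝓘(ℝ, E) 𝓘(ℝ, E) κ.symm (κ x)) :=
      mfderiv_comp _ (mdifferentiableAt_chart (by rwa [hκx])) (mdifferentiableAt_chart_symm hxt)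
    rw [mfderiv_eq_fderiv] at hcomp
    rw [hcomp]
    have h5 := mfderiv_symm_mfderiv_chart hxt
    rw [← hκ, hκx] at h5
    -- Differentials at equal points have formally different types. Reading them as maps of `E`
    -- allows the transport.
    have hpt : ∀ p q : V, p = q → ∀ w : E, (mfderiv 𝓘(ℝ, E) 𝓘(ℝ, E) ψ p : E →L[ℝ] E) w =
        (mfderiv 𝓘(ℝ, E) 𝓘(ℝ, E) ψ q : E →L[ℝ] E) w := by
      rintro p q rfl w
      rfl
    exact (hpt _ _ hκx _).trans
      (congrArg (mfderiv 𝓘(ℝ, E) 𝓘(ℝ, E) ψ x : E →L[ℝ] E) (h5 w))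
  rw [dForm_apply]
  have key := extDeriv_pullback hA hτ (formInChart_eventuallyEq a x₀ x hx)
    (mfderiv 𝓘(ℝ, E) 𝓘(ℝ, E) κ x u) (mfderiv 𝓘(ℝ, E) 𝓘(ℝ, E) κ x v)
  rw [hT, hT, hτx] at key
  exact key

end Forms

section Forms

variable {E : Type*} [NormedAddCommGroup E] [NormedSpace ℝ E]
  {V : Type*} [TopologicalSpace V] [ChartedSpace E V] [IsManifold 𝓘(ℝ, E) ∞ V]

theorem contDiffOn_comp_chart_symm {h : V → ℝ} (hh : ContMDiff 𝓘(ℝ, E) 𝓘(ℝ, ℝ) ∞ h) (x₀ : V) :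
    ContDiffOn ℝ ∞ (h ∘ (extChartAt 𝓘(ℝ, E) x₀).symm) (extChartAt 𝓘(ℝ, E) x₀).target := by
  rw [← contMDiffOn_iff_contDiffOn]
  exact hh.comp_contMDiffOn (contMDiffOn_extChartAt_symm x₀)

theorem dFun_chart {h : V → ℝ} (hh : ContMDiff 𝓘(ℝ, E) 𝓘(ℝ, ℝ) ∞ h) {x₀ : V} {y : E}
    (hy : y ∈ (extChartAt 𝓘(ℝ, E) x₀).target) (u : E) :
    fderiv ℝ (h ∘ (extChartAt 𝓘(ℝ, E) x₀).symm) y u =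
      ContactForm.dFun h ((extChartAt 𝓘(ℝ, E) x₀).symm y)
        (mfderiv 𝓘(ℝ, E) 𝓘(ℝ, E) (extChartAt 𝓘(ℝ, E) x₀).symm y u) := by
  have hcomp := mfderiv_comp (I := 𝓘(ℝ, E)) (I' := 𝓘(ℝ, E)) (I'' := 𝓘(ℝ, ℝ)) y
    (hh.mdifferentiable (by simp) _) (mdifferentiableAt_chart_symm hy)
  rw [mfderiv_eq_fderiv] at hcomp
  rw [hcomp]
  rfl

variable (α : ContactForm E V)

namespace ContactForm

/-- The coordinate expression of the map `v ↦ dα(v, ·) + α(v) α`. -/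
noncomputable def toDualInChart (x₀ : V) (y : E) : E →L[ℝ] E →L[ℝ] ℝ :=
  fderiv ℝ (formInChart α.form x₀) y - (fderiv ℝ (formInChart α.form x₀) y).flip +
    (formInChart α.form x₀ y).smulRight (formInChart α.form x₀ y)

theorem toDualInChart_apply (x₀ : V) (y u v : E) :
    α.toDualInChart x₀ y u v =
      fderiv ℝ (formInChart α.form x₀) y u v - fderiv ℝ (formInChart α.form x₀) y v u +
        formInChart α.form x₀ y u * formInChart α.form x₀ y v := by
  simp [toDualInChart]

theorem contDiffOn_toDualInChart (x₀ : V) :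
    ContDiffOn ℝ ∞ (α.toDualInChart x₀) (extChartAt 𝓘(ℝ, E) x₀).target := by
  have hA := contDiffOn_formInChart α.smooth x₀
  have hD : ContDiffOn ℝ ∞ (fderiv ℝ (formInChart α.form x₀)) (extChartAt 𝓘(ℝ, E) x₀).target :=
    hA.fderiv_of_isOpen (isOpen_extChartAt_target x₀) (by simp)
  let flip : (E →L[ℝ] E →L[ℝ] ℝ) →L[ℝ] (E →L[ℝ] E →L[ℝ] ℝ) :=
    (ContinuousLinearMap.flipₗᵢ ℝ E E ℝ).toContinuousLinearEquiv.toContinuousLinearMap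
  have hflip : ContDiffOn ℝ ∞ (fun y => (fderiv ℝ (formInChart α.form x₀) y).flip)
      (extChartAt 𝓘(ℝ, E) x₀).target :=
    ContDiff.comp_contDiffOn (g := flip) (ContinuousLinearMap.contDiff (𝕜 := ℝ)
      (E := E →L[ℝ] E →L[ℝ] ℝ) (F := E →L[ℝ] E →L[ℝ] ℝ) flip) hD
  exact (hD.sub hflip).add (hA.smulRight hA)

/-- By definition `dForm` uses a chart that varies with the point. Here it is expressed in the
single chart at `x₀`, where smoothness in the point can be read off. -/
theorem dForm_in_chart {x₀ : V} {y : E} (hy : y ∈ (extChartAt 𝓘(ℝ, E) x₀).target) (u v : E) :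
    dForm α.form ((extChartAt 𝓘(ℝ, E) x₀).symm y)
      (mfderiv 𝓘(ℝ, E) 𝓘(ℝ, E) (extChartAt 𝓘(ℝ, E) x₀).symm y u)
      (mfderiv 𝓘(ℝ, E) 𝓘(ℝ, E) (extChartAt 𝓘(ℝ, E) x₀).symm y v) =
    fderiv ℝ (formInChart α.form x₀) y u v - fderiv ℝ (formInChart α.form x₀) y v u := by
  rw [dForm_chart (contDiffOn_formInChart α.smooth x₀)
    ((extChartAt 𝓘(ℝ, E) x₀).map_target hy), (extChartAt 𝓘(ℝ, E) x₀).right_inv hy]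
  have h1 := mfderiv_chart_mfderiv_symm hy u
  have h2 := mfderiv_chart_mfderiv_symm hy v
  exact congrArg₂ (fun a b : E => fderiv ℝ (formInChart α.form x₀) y a b -
    fderiv ℝ (formInChart α.form x₀) y b a) h1 h2

theorem toDualInChart_eq {x₀ : V} {y : E} (hy : y ∈ (extChartAt 𝓘(ℝ, E) x₀).target) (u v : E) :
    α.toDualInChart x₀ y u v =
      dForm α.form ((extChartAt 𝓘(ℝ, E) x₀).symm y)
        (mfderiv 𝓘(ℝ, E) 𝓘(ℝ, E) (extChartAt 𝓘(ℝ, E) x₀).symm y u)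
        (mfderiv 𝓘(ℝ, E) 𝓘(ℝ, E) (extChartAt 𝓘(ℝ, E) x₀).symm y v) +
      formInChart α.form x₀ y u * formInChart α.form x₀ y v := by
  rw [toDualInChart_apply, dForm_in_chart α hy]

theorem formInChart_fieldInChart (v : ∀ x : V, TangentSpace 𝓘(ℝ, E) x) {x₀ : V} {y : E}
    (hy : y ∈ (extChartAt 𝓘(ℝ, E) x₀).target) :
    formInChart α.form x₀ y (fieldInChart v x₀ y) =
      α.form ((extChartAt 𝓘(ℝ, E) x₀).symm y) (v ((extChartAt 𝓘(ℝ, E) x₀).symm y)) :=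
  formInChart_mfderiv_chart α.form hy _

theorem toDualInChart_fieldInChart (v : ∀ x : V, TangentSpace 𝓘(ℝ, E) x) {x₀ : V} {y : E}
    (hy : y ∈ (extChartAt 𝓘(ℝ, E) x₀).target) (u : E) :
    α.toDualInChart x₀ y (fieldInChart v x₀ y) u =
      dForm α.form ((extChartAt 𝓘(ℝ, E) x₀).symm y) (v ((extChartAt 𝓘(ℝ, E) x₀).symm y))
        (mfderiv 𝓘(ℝ, E) 𝓘(ℝ, E) (extChartAt 𝓘(ℝ, E) x₀).symm y u) +
      α.form ((extChartAt 𝓘(ℝ, E) x₀).symm y) (v ((extChartAt 𝓘(ℝ, E) x₀).symm y)) *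
        formInChart α.form x₀ y u := by
  rw [toDualInChart_eq α hy, formInChart_fieldInChart α v hy]
  have h := mfderiv_symm_fieldInChart v hy
  exact congrArg (fun w : TangentSpace 𝓘(ℝ, E) ((extChartAt 𝓘(ℝ, E) x₀).symm y) =>
    dForm α.form ((extChartAt 𝓘(ℝ, E) x₀).symm y) w
        (mfderiv 𝓘(ℝ, E) 𝓘(ℝ, E) (extChartAt 𝓘(ℝ, E) x₀).symm y u) +
      α.form ((extChartAt 𝓘(ℝ, E) x₀).symm y) (v ((extChartAt 𝓘(ℝ, E) x₀).symm y)) *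
        formInChart α.form x₀ y u) h

variable [FiniteDimensional ℝ E]

/-- Pairing `u` with itself kills the antisymmetric part and leaves `α(u)²`. A kernel vector
therefore lies in `ξ`, where nondegeneracy makes it zero, and equality of dimensions does the rest.
-/
theorem isInvertible_toDualInChart {x₀ : V} {y : E} (hy : y ∈ (extChartAt 𝓘(ℝ, E) x₀).target) :
    (α.toDualInChart x₀ y).IsInvertible := by
  have hinj : Function.Injective (α.toDualInChart x₀ y) := by
    rw [injective_iff_map_eq_zero]
    intro u hu
    have h1 : ∀ v : E, α.toDualInChart x₀ y u v = 0 := fun v => by rw [hu]; rfl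
    set D : E →L[ℝ] E := mfderiv 𝓘(ℝ, E) 𝓘(ℝ, E) (extChartAt 𝓘(ℝ, E) x₀).symm y with hD
    have hu0 : formInChart α.form x₀ y u = 0 := by
      have := h1 u
      rw [toDualInChart_apply, sub_self, zero_add] at this
      exact mul_self_eq_zero.mp this
    have hDu : D u = 0 := by
      refine α.nondegenerate ((extChartAt 𝓘(ℝ, E) x₀).symm y) (D u) hu0 fun w _ => ?_
      let w' : E := mfderiv 𝓘(ℝ, E) 𝓘(ℝ, E) (extChartAt 𝓘(ℝ, E) x₀)
        ((extChartAt 𝓘(ℝ, E) x₀).symm y) w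
      have h2 := h1 w'
      rw [toDualInChart_eq α hy, hu0, zero_mul, add_zero] at h2
      exact (congrArg (dForm α.form ((extChartAt 𝓘(ℝ, E) x₀).symm y) (D u))
        (mfderiv_symm_mfderiv_chart hy w)).symm.trans h2
    have h3 := mfderiv_chart_mfderiv_symm hy u
    refine h3.symm.trans ?_
    exact (congrArg (mfderiv 𝓘(ℝ, E) 𝓘(ℝ, E) (extChartAt 𝓘(ℝ, E) x₀)
        ((extChartAt 𝓘(ℝ, E) x₀).symm y) : E →L[ℝ] E) hDu).trans (map_zero _)
  have hdim : Module.finrank ℝ E = Module.finrank ℝ (E →L[ℝ] ℝ) := by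
    rw [← (LinearMap.toContinuousLinearMap (𝕜 := ℝ) (E := E) (F' := ℝ)).finrank_eq]
    exact (Subspace.dual_finrank_eq (K := ℝ) (V := E)).symm
  exact ⟨(LinearEquiv.ofInjectiveOfFinrankEq (α.toDualInChart x₀ y).toLinearMap hinj
    hdim).toContinuousLinearEquiv, by ext; rfl⟩

/-- A vector field whose image under `v ↦ dα(v, ·) + α(v) α` is smooth in charts is smooth. -/
theorem contDiffOn_of_toDualInChart {x₀ : V} {f : E → E} {g : E → E →L[ℝ] ℝ}
    (hg : ContDiffOn ℝ ∞ g (extChartAt 𝓘(ℝ, E) x₀).target)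
    (hfg : ∀ y ∈ (extChartAt 𝓘(ℝ, E) x₀).target, α.toDualInChart x₀ y (f y) = g y) :
    ContDiffOn ℝ ∞ f (extChartAt 𝓘(ℝ, E) x₀).target := by
  have : CompleteSpace E := FiniteDimensional.complete ℝ E
  intro y hy
  have h1 : ContDiffWithinAt ℝ ∞ (fun y => (α.toDualInChart x₀ y).inverse)
      (extChartAt 𝓘(ℝ, E) x₀).target y :=
    (α.isInvertible_toDualInChart hy).contDiffAt_map_inverse.comp_contDiffWithinAt y
      (α.contDiffOn_toDualInChart x₀ y hy)
  refine (h1.clm_apply (hg y hy)).congr_of_mem (fun z hz => ?_) hy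
  rw [← hfg z hz, (α.isInvertible_toDualInChart hz).inverse_apply_eq.mpr rfl]

/-- The Reeb equations say that `v ↦ dα(v, ·) + α(v) α` sends `R` to `α`, which is smooth. -/
theorem contDiffOn_reeb (x₀ : V) :
    ContDiffOn ℝ ∞ (fieldInChart α.reeb x₀) (extChartAt 𝓘(ℝ, E) x₀).target := by
  refine α.contDiffOn_of_toDualInChart (contDiffOn_formInChart α.smooth x₀) fun y hy => ?_
  refine ContinuousLinearMap.ext fun u => ?_
  rw [toDualInChart_fieldInChart α _ hy, (α.reeb_spec _).1, (α.reeb_spec _).2, zero_add, one_mul]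

/-- Here the image under `v ↦ dα(v, ·) + α(v) α` is `-dh + (dh(R) + h) α`. -/
theorem contDiffOn_contactVectorField {h : V → ℝ} (hh : ContMDiff 𝓘(ℝ, E) 𝓘(ℝ, ℝ) ∞ h) (x₀ : V) :
    ContDiffOn ℝ ∞ (fieldInChart (α.contactVectorField h) x₀)
      (extChartAt 𝓘(ℝ, E) x₀).target := by
  have hk := contDiffOn_comp_chart_symm hh x₀
  have hD := hk.fderiv_of_isOpen (m := ∞) (isOpen_extChartAt_target x₀) (by simp)
  refine α.contDiffOn_of_toDualInChart
    (g := fun y => -fderiv ℝ (h ∘ (extChartAt 𝓘(ℝ, E) x₀).symm) y +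
      (fderiv ℝ (h ∘ (extChartAt 𝓘(ℝ, E) x₀).symm) y (fieldInChart α.reeb x₀ y) +
        (h ∘ (extChartAt 𝓘(ℝ, E) x₀).symm) y) • formInChart α.form x₀ y)
    (hD.neg.add (((hD.clm_apply (α.contDiffOn_reeb x₀)).add hk).smul
      (contDiffOn_formInChart α.smooth x₀))) fun y hy => ?_
  refine ContinuousLinearMap.ext fun u => ?_
  rw [toDualInChart_fieldInChart α _ hy, (α.contactVectorField_spec h _).1,
    (α.contactVectorField_spec h _).2]
  have hR : fderiv ℝ (h ∘ (extChartAt 𝓘(ℝ, E) x₀).symm) y (fieldInChart α.reeb x₀ y) =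
      dFun h ((extChartAt 𝓘(ℝ, E) x₀).symm y) (α.reeb ((extChartAt 𝓘(ℝ, E) x₀).symm y)) :=
    (dFun_chart hh hy _).trans (congrArg _ (mfderiv_symm_fieldInChart α.reeb hy))
  have hu : formInChart α.form x₀ y u = α.form ((extChartAt 𝓘(ℝ, E) x₀).symm y)
      (mfderiv 𝓘(ℝ, E) 𝓘(ℝ, E) (extChartAt 𝓘(ℝ, E) x₀).symm y u) := rfl
  simp only [add_apply, neg_apply, smul_apply, smul_eq_mul, Function.comp_apply]
  rw [hR, dFun_chart hh hy u, hu]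
  ring

/-- The contact vector field of a smooth function is smooth. -/
theorem contMDiff_contactVectorField {h : V → ℝ} (hh : ContMDiff 𝓘(ℝ, E) 𝓘(ℝ, ℝ) ∞ h) :
    ContMDiff 𝓘(ℝ, E) 𝓘(ℝ, E).tangent ∞
      (fun x => (⟨x, α.contactVectorField h x⟩ : TangentBundle 𝓘(ℝ, E) V)) :=
  (contMDiff_iff_fieldInChart _).mpr (α.contDiffOn_contactVectorField hh)

/-- The function `dh(R)` is continuous. -/
theorem continuous_dFun_reeb {h : V → ℝ} (hh : ContMDiff 𝓘(ℝ, E) 𝓘(ℝ, ℝ) ∞ h) :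
    Continuous fun x => dFun h x (α.reeb x) := by
  rw [continuous_iff_continuousAt]
  intro x₀
  have hD := (contDiffOn_comp_chart_symm hh x₀).fderiv_of_isOpen (m := ∞)
    (isOpen_extChartAt_target x₀) (by simp)
  have h1 : ContinuousAt (fun x => fderiv ℝ (h ∘ (extChartAt 𝓘(ℝ, E) x₀).symm)
      (extChartAt 𝓘(ℝ, E) x₀ x) (fieldInChart α.reeb x₀ (extChartAt 𝓘(ℝ, E) x₀ x))) x₀ :=
    ((hD.clm_apply (α.contDiffOn_reeb x₀)).continuousOn.continuousAt
      (extChartAt_target_mem_nhds x₀)).comp (continuousAt_extChartAt x₀)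
  refine h1.congr ?_
  filter_upwards [extChartAt_source_mem_nhds (I := 𝓘(ℝ, E)) x₀] with x hx
  have hy := (extChartAt 𝓘(ℝ, E) x₀).map_source hx
  have h2 := (dFun_chart hh hy _).trans (congrArg _ (mfderiv_symm_fieldInChart α.reeb hy))
  rw [(extChartAt 𝓘(ℝ, E) x₀).left_inv hx] at h2
  exact h2

end ContactForm

end Forms

/-! ### Contact flows preserve the contact structure. -/

section Preservation

variable {E : Type*} [NormedAddCommGroup E] [NormedSpace ℝ E]

/-- Cartan's formula for the variation of a 1-form `A` along the flow `F` of a vector field `Y`. -/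
theorem hasDerivAt_form_along_flow {F : ℝ × E → E} {t₀ : ℝ} {z₀ : E}
    (hF : ContDiffAt ℝ 2 F (t₀, z₀)) {Y : E → E} (hY : DifferentiableAt ℝ Y (F (t₀, z₀)))
    (hflow : ∀ᶠ p in 𝓝 (t₀, z₀), HasDerivAt (fun t => F (t, p.2)) (Y (F p)) p.1)
    {A : E → E →L[ℝ] ℝ} (hA : DifferentiableAt ℝ A (F (t₀, z₀))) {k : E → ℝ}
    (hk : k =ᶠ[𝓝 (F (t₀, z₀))] fun y => A y (Y y)) (v : E) :
    HasDerivAt (fun t => A (F (t, z₀)) (fderiv ℝ F (t, z₀) (0, v)))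
      (fderiv ℝ A (F (t₀, z₀)) (Y (F (t₀, z₀))) (fderiv ℝ F (t₀, z₀) (0, v)) -
        fderiv ℝ A (F (t₀, z₀)) (fderiv ℝ F (t₀, z₀) (0, v)) (Y (F (t₀, z₀))) +
        fderiv ℝ k (F (t₀, z₀)) (fderiv ℝ F (t₀, z₀) (0, v))) t₀ := by
  set q := F (t₀, z₀) with hq
  set w := fderiv ℝ F (t₀, z₀) (0, v) with hw
  have hdF : DifferentiableAt ℝ (fderiv ℝ F) (t₀, z₀) :=
    (hF.fderiv_right (m := 1) (by norm_num)).differentiableAt (by norm_num)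
  have hpath : HasDerivAt (fun t : ℝ => (t, z₀)) ((1 : ℝ), (0 : E)) t₀ :=
    (hasDerivAt_id t₀).prodMk (hasDerivAt_const t₀ z₀)
  have hsymm := hF.isSymmSndFDerivAt (by simp)
  have hFd : HasFDerivAt F (fderiv ℝ F (t₀, z₀)) (t₀, z₀) :=
    (hF.differentiableAt (by norm_num)).hasFDerivAt
  -- the time derivative of `F`
  have htime : (fun p => fderiv ℝ F p (1, 0)) =ᶠ[𝓝 (t₀, z₀)] fun p => Y (F p) := by
    filter_upwards [hflow, hF.eventually (by simp)] with p hp hpF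
    have h1 : HasDerivAt (fun t : ℝ => (t, p.2)) ((1 : ℝ), (0 : E)) p.1 :=
      (hasDerivAt_id p.1).prodMk (hasDerivAt_const p.1 p.2)
    exact ((hpF.differentiableAt (by norm_num)).hasFDerivAt.comp_hasDerivAt p.1 h1).unique hp
  -- Symmetry of the second derivative of `F` exchanges the time and space derivatives, which gives
  -- the linearized equation for the transported vector.
  have hmixed : fderiv ℝ (fderiv ℝ F) (t₀, z₀) (1, 0) (0, v) = fderiv ℝ Y q w := by
    have h1 : HasFDerivAt (fun p => fderiv ℝ F p (1, 0))
        ((ContinuousLinearMap.apply ℝ E ((1 : ℝ), (0 : E))).comp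
          (fderiv ℝ (fderiv ℝ F) (t₀, z₀))) (t₀, z₀) :=
      (ContinuousLinearMap.apply ℝ E ((1 : ℝ), (0 : E))).hasFDerivAt.comp (t₀, z₀) hdF.hasFDerivAt
    have h2 : HasFDerivAt (fun p => Y (F p)) ((fderiv ℝ Y q).comp (fderiv ℝ F (t₀, z₀))) (t₀, z₀) :=
      hY.hasFDerivAt.comp (t₀, z₀) hFd
    have h3 := congrArg (fun L => L ((0 : ℝ), v)) (h1.unique (h2.congr_of_eventuallyEq htime))
    rw [hsymm.eq]
    exact h3
  have hW : HasDerivAt (fun t => fderiv ℝ F (t, z₀) (0, v)) (fderiv ℝ Y q w) t₀ := by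
    rw [← hmixed]
    exact (ContinuousLinearMap.apply ℝ E ((0 : ℝ), v)).hasFDerivAt.comp_hasDerivAt t₀
      (hdF.hasFDerivAt.comp_hasDerivAt t₀ hpath)
  have hAt : HasDerivAt (fun t => A (F (t, z₀))) (fderiv ℝ A q (Y q)) t₀ := by
    have h1 := hflow.self_of_nhds
    exact hA.hasFDerivAt.comp_hasDerivAt t₀ h1
  -- Differentiating `k = A(Y)` produces the term `A(DY w)`; what remains of the time derivative is
  -- `dA(Y, w)`.
  have hkd : fderiv ℝ k q w = fderiv ℝ A q w (Y q) + A q (fderiv ℝ Y q w) := by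
    have h1 := (hA.hasFDerivAt.clm_apply hY.hasFDerivAt).congr_of_eventuallyEq hk
    rw [h1.fderiv]
    simp [add_comm]
  refine (hAt.clm_apply hW).congr_deriv ?_
  rw [hkd]
  ring

/-- A solution of a linear scalar equation vanishes identically or nowhere. -/
theorem eq_zero_iff_of_hasDerivAt {f g : ℝ → ℝ} (hg : Continuous g)
    (hf : ∀ t, HasDerivAt f (g t * f t) t) (s t : ℝ) : f s = 0 ↔ f t = 0 := by
  have hI : ∀ t, HasDerivAt (fun t => ∫ τ in (0 : ℝ)..t, g τ) (g t) t := fun t =>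
    intervalIntegral.integral_hasDerivAt_right (hg.intervalIntegrable _ _)
      hg.aestronglyMeasurable.stronglyMeasurableAtFilter hg.continuousAt
  -- The integrating factor makes the product constant, and it never vanishes.
  have hc : ∀ t, HasDerivAt (fun t => f t * Real.exp (-∫ τ in (0 : ℝ)..t, g τ)) 0 t := fun t => by
    refine ((hf t).mul (hI t).fun_neg.exp).congr_deriv ?_
    ring
  have h := is_const_of_deriv_eq_zero (fun t => (hc t).differentiableAt)
    (fun t => (hc t).deriv) s t
  have hs := Real.exp_ne_zero (-∫ τ in (0 : ℝ)..s, g τ)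
  have ht := Real.exp_ne_zero (-∫ τ in (0 : ℝ)..t, g τ)
  constructor
  · intro h0
    simpa [h0, ht] using h.symm
  · intro h0
    simpa [h0, hs] using h

variable [FiniteDimensional ℝ E]
  {V : Type*} [TopologicalSpace V] [ChartedSpace E V] [IsManifold 𝓘(ℝ, E) ∞ V]
  (α : ContactForm E V)

namespace ContactForm

/-- In a chart, the Lie derivative of `α` along the contact vector field of `h` is `dh(R) α`. -/
theorem lieDerivative_chart {h : V → ℝ} (hh : ContMDiff 𝓘(ℝ, E) 𝓘(ℝ, ℝ) ∞ h) {x₀ : V} {y : E}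
    (hy : y ∈ (extChartAt 𝓘(ℝ, E) x₀).target) (w : E) :
    fderiv ℝ (formInChart α.form x₀) y (fieldInChart (α.contactVectorField h) x₀ y) w -
      fderiv ℝ (formInChart α.form x₀) y w (fieldInChart (α.contactVectorField h) x₀ y) +
      fderiv ℝ (h ∘ (extChartAt 𝓘(ℝ, E) x₀).symm) y w =
    dFun h ((extChartAt 𝓘(ℝ, E) x₀).symm y) (α.reeb ((extChartAt 𝓘(ℝ, E) x₀).symm y)) *
      formInChart α.form x₀ y w := by
  rw [← dForm_in_chart α hy, dFun_chart hh hy, formInChart_apply]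
  have h1 := (α.contactVectorField_spec h ((extChartAt 𝓘(ℝ, E) x₀).symm y)).2
    (mfderiv 𝓘(ℝ, E) 𝓘(ℝ, E) (extChartAt 𝓘(ℝ, E) x₀).symm y w)
  have h2 := congrArg (fun u => dForm α.form ((extChartAt 𝓘(ℝ, E) x₀).symm y) u
    (mfderiv 𝓘(ℝ, E) 𝓘(ℝ, E) (extChartAt 𝓘(ℝ, E) x₀).symm y w))
    (mfderiv_symm_fieldInChart (α.contactVectorField h) hy)
  have h3 := h2.trans h1
  beta_reduce at h3
  linarith

/-- Since the Lie derivative of `α` along the contact field is `dh(R) α`, the number `α(dφ_t v)`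
obeys a scalar linear equation. The claim is local in `t`, so one chart at `x` and one at `φ t₀ x`
suffice. -/
theorem hasDerivAt_form_flow {h : V → ℝ} (hh : ContMDiff 𝓘(ℝ, E) 𝓘(ℝ, ℝ) ∞ h)
    {φ : ℝ → V → V}
    (hφ : ∀ x, IsMIntegralCurve (I := 𝓘(ℝ, E)) (fun t => φ t x) (α.contactVectorField h))
    (hφs : ContMDiff (𝓘(ℝ, ℝ).prod 𝓘(ℝ, E)) 𝓘(ℝ, E) ∞ (fun p : ℝ × V => φ p.1 p.2))
    (x : V) (v : TangentSpace 𝓘(ℝ, E) x) (t₀ : ℝ) :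
    HasDerivAt (fun t => α.form (φ t x) (mfderiv 𝓘(ℝ, E) 𝓘(ℝ, E) (φ t) x v))
      (dFun h (φ t₀ x) (α.reeb (φ t₀ x)) *
        α.form (φ t₀ x) (mfderiv 𝓘(ℝ, E) 𝓘(ℝ, E) (φ t₀) x v)) t₀ := by
  set ψ := extChartAt 𝓘(ℝ, E) (φ t₀ x) with hψ
  set κ := extChartAt 𝓘(ℝ, E) x with hκ
  have hκx : κ.symm (κ x) = x := κ.left_inv (mem_extChartAt_source x)
  have hxt : κ x ∈ κ.target := mem_extChartAt_target x
  have hpsrc : φ t₀ x ∈ ψ.source := mem_extChartAt_source (φ t₀ x)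
  have hslice : ∀ t, ContMDiff 𝓘(ℝ, E) 𝓘(ℝ, E) ∞ (φ t) := fun t =>
    hφs.comp (contMDiff_const.prodMk contMDiff_id)
  set F : ℝ × E → E := fun p => ψ (φ p.1 (κ.symm p.2)) with hFdef
  have hF0 : F (t₀, κ x) = ψ (φ t₀ x) := by simp only [F, hκx]
  have hbase : ContMDiffAt 𝓘(ℝ, ℝ × E) 𝓘(ℝ, E) ∞ (fun p : ℝ × E => φ p.1 (κ.symm p.2))
      (t₀, κ x) := by
    have h1 : ContMDiffAt 𝓘(ℝ, E) 𝓘(ℝ, E) ∞ κ.symm (κ x) :=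
      (contMDiffOn_extChartAt_symm x _ hxt).contMDiffAt (extChartAt_target_mem_nhds x)
    have h2 : ContMDiffAt 𝓘(ℝ, ℝ × E) 𝓘(ℝ, E) ∞ (fun p : ℝ × E => κ.symm p.2) (t₀, κ x) :=
      ContMDiffAt.comp (t₀, κ x) (I' := 𝓘(ℝ, E)) h1 contDiff_snd.contMDiff.contMDiffAt
    have h3 : ContMDiffAt 𝓘(ℝ, ℝ × E) 𝓘(ℝ, ℝ) ∞ (fun p : ℝ × E => p.1) (t₀, κ x) :=
      contDiff_fst.contMDiff.contMDiffAt
    exact ContMDiffAt.comp (t₀, κ x) hφs.contMDiffAt (h3.prodMk h2)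
  have hF : ContDiffAt ℝ 2 F (t₀, κ x) := by
    rw [← contMDiffAt_iff_contDiffAt]
    have h1 : ContMDiffAt 𝓘(ℝ, E) 𝓘(ℝ, E) ∞ ψ (φ t₀ (κ.symm (κ x))) := by
      rw [hκx]
      exact contMDiffAt_extChartAt
    exact (ContMDiffAt.comp (t₀, κ x) h1 hbase).of_le two_le_infty
  have hnear : ∀ᶠ p in 𝓝 (t₀, κ x), φ p.1 (κ.symm p.2) ∈ ψ.source :=
    hbase.continuousAt.eventually
      (by simp only [hκx]; exact (isOpen_extChartAt_source _).mem_nhds hpsrc)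
  have hflow : ∀ᶠ p in 𝓝 (t₀, κ x), HasDerivAt (fun t => F (t, p.2))
      (fieldInChart (α.contactVectorField h) (φ t₀ x) (F p)) p.1 := by
    filter_upwards [hnear] with p hp
    have h1 := (mdifferentiableAt_chart hp).hasMFDerivAt.comp p.1 (hφ (κ.symm p.2) p.1)
    let L : E →L[ℝ] E := mfderiv 𝓘(ℝ, E) 𝓘(ℝ, E) ψ (φ p.1 (κ.symm p.2))
    let X : E := α.contactVectorField h (φ p.1 (κ.symm p.2))
    have h2 : HasFDerivAt (fun t => F (t, p.2))
        (L.comp ((1 : ℝ →L[ℝ] ℝ).smulRight X)) p.1 :=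
      hasMFDerivAt_iff_hasFDerivAt.mp h1
    refine h2.hasDerivAt.congr_deriv ?_
    have hpt : ∀ a b : V, a = b → ((mfderiv 𝓘(ℝ, E) 𝓘(ℝ, E) ψ a : E →L[ℝ] E)
        (α.contactVectorField h a)) = (mfderiv 𝓘(ℝ, E) 𝓘(ℝ, E) ψ b : E →L[ℝ] E)
        (α.contactVectorField h b) := by
      rintro a b rfl
      rfl
    refine Eq.trans ?_ (hpt _ _ (ψ.left_inv hp).symm)
    exact congrArg L (one_smul ℝ X)
  have hA : DifferentiableAt ℝ (formInChart α.form (φ t₀ x)) (F (t₀, κ x)) := by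
    rw [hF0]
    exact ((contDiffOn_formInChart α.smooth (φ t₀ x)).contDiffAt
      (extChartAt_target_mem_nhds _)).differentiableAt (by simp)
  have hY : DifferentiableAt ℝ (fieldInChart (α.contactVectorField h) (φ t₀ x))
      (F (t₀, κ x)) := by
    rw [hF0]
    exact ((α.contDiffOn_contactVectorField hh (φ t₀ x)).contDiffAt
      (extChartAt_target_mem_nhds _)).differentiableAt (by simp)
  have hk : h ∘ ψ.symm =ᶠ[𝓝 (F (t₀, κ x))] fun y => formInChart α.form (φ t₀ x) y
      (fieldInChart (α.contactVectorField h) (φ t₀ x) y) := by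
    rw [hF0]
    filter_upwards [extChartAt_target_mem_nhds (I := 𝓘(ℝ, E)) (φ t₀ x)] with y hy
    rw [formInChart_fieldInChart α _ hy, (α.contactVectorField_spec h _).1]
    rfl
  let v' : E := mfderiv 𝓘(ℝ, E) 𝓘(ℝ, E) κ x v
  have hW : ∀ᶠ t in 𝓝 t₀, formInChart α.form (φ t₀ x) (F (t, κ x))
      (fderiv ℝ F (t, κ x) (0, v')) =
        α.form (φ t x) (mfderiv 𝓘(ℝ, E) 𝓘(ℝ, E) (φ t) x v) := by
    have hct : ContinuousAt (fun t : ℝ => (t, κ x)) t₀ := by fun_prop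
    filter_upwards [hct.eventually hnear, hct.eventually (hF.eventually (by simp))] with t ht htF
    have ht' : φ t x ∈ ψ.source := by simpa only [hκx] using ht
    have h1 : fderiv ℝ F (t, κ x) (0, v') =
        fderiv ℝ (fun z => ψ (φ t (κ.symm z))) (κ x) v' :=
      (((htF.differentiableAt (by norm_num)).hasFDerivAt.comp (κ x)
        (hasFDerivAt_prodMk_right t (κ x))).fderiv ▸ rfl)
    have h2 : mfderiv 𝓘(ℝ, E) 𝓘(ℝ, E) ((ψ ∘ φ t) ∘ κ.symm) (κ x) =
        (mfderiv 𝓘(ℝ, E) 𝓘(ℝ, E) (ψ ∘ φ t) (κ.symm (κ x))).comp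
          (mfderiv 𝓘(ℝ, E) 𝓘(ℝ, E) κ.symm (κ x)) :=
      mfderiv_comp _ ((mdifferentiableAt_chart ht).comp _
        ((hslice t).mdifferentiable (by simp) _)) (mdifferentiableAt_chart_symm hxt)
    rw [mfderiv_eq_fderiv] at h2
    have h3 : mfderiv 𝓘(ℝ, E) 𝓘(ℝ, E) (ψ ∘ φ t) x =
        (mfderiv 𝓘(ℝ, E) 𝓘(ℝ, E) ψ (φ t x)).comp (mfderiv 𝓘(ℝ, E) 𝓘(ℝ, E) (φ t) x) :=
      mfderiv_comp x (mdifferentiableAt_chart ht') ((hslice t).mdifferentiable (by simp) _)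
    have h5 := mfderiv_symm_mfderiv_chart hxt
    rw [← hκ, hκx] at h5
    have hpt : ∀ p q : V, p = q → ∀ w : E,
        (mfderiv 𝓘(ℝ, E) 𝓘(ℝ, E) (ψ ∘ φ t) p : E →L[ℝ] E) w =
        (mfderiv 𝓘(ℝ, E) 𝓘(ℝ, E) (ψ ∘ φ t) q : E →L[ℝ] E) w := by
      rintro p q rfl w
      rfl
    have h6 : fderiv ℝ F (t, κ x) (0, v') = (mfderiv 𝓘(ℝ, E) 𝓘(ℝ, E) ψ (φ t x) : E →L[ℝ] E)
        ((mfderiv 𝓘(ℝ, E) 𝓘(ℝ, E) (φ t) x : E →L[ℝ] E) v) := by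
      refine h1.trans ((congrArg (fun L : E →L[ℝ] E => L v') h2).trans ?_)
      refine (hpt _ _ hκx _).trans ?_
      refine (congrArg (mfderiv 𝓘(ℝ, E) 𝓘(ℝ, E) (ψ ∘ φ t) x : E →L[ℝ] E) (h5 v)).trans ?_
      exact congrArg (fun L : E →L[ℝ] E => L v) h3
    have h7 := formInChart_mfderiv_chart α.form (ψ.map_source ht')
    rw [← hψ, ψ.left_inv ht'] at h7
    rw [h6]
    simp only [F, hκx]
    exact h7 _
  have key := hasDerivAt_form_along_flow hF hY hflow hA hk v'
  refine (key.congr_of_eventuallyEq (hW.mono fun _ h => h.symm)).congr_deriv ?_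
  rw [α.lieDerivative_chart hh (by rw [hF0]; exact ψ.map_source hpsrc), hW.self_of_nhds, hF0]
  exact congrArg (fun p => dFun h p (α.reeb p) * _) (ψ.left_inv hpsrc)

end ContactForm

end Preservation

/-! ### Contact isotopies of autonomous Hamiltonians. -/

section Existence

variable {E : Type*} [NormedAddCommGroup E] [NormedSpace ℝ E] [FiniteDimensional ℝ E]
  {V : Type*} [TopologicalSpace V] [T2Space V] [CompactSpace V] [ChartedSpace E V]
  [IsManifold 𝓘(ℝ, E) ∞ V] (α : ContactForm E V)

/-- On a closed manifold, every autonomous contact Hamiltonian generates a contact isotopy. -/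
theorem ContactForm.exists_generates (h : C^∞⟮𝓘(ℝ, E), V; 𝓘(ℝ, ℝ), ℝ⟯) :
    ∃ φ : isotopyGroup α.ker, α.Generates (autonomous h) φ := by
  have hh : ContMDiff 𝓘(ℝ, E) 𝓘(ℝ, ℝ) ∞ h := h.contMDiff
  obtain ⟨φ, h0, hadd, hint, hsm⟩ := exists_flow (α.contMDiff_contactVectorField hh)
  have hid : φ 0 = id := funext h0
  let Φ : ℝ → Equiv.Perm V := fun t =>
    ⟨φ t, φ (-t), fun x => by rw [← hadd, neg_add_cancel, h0],
      fun x => by rw [← hadd, add_neg_cancel, h0]⟩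
  have hslice : ∀ t, ContMDiff 𝓘(ℝ, E) 𝓘(ℝ, E) ∞ (φ t) := fun t =>
    hsm.comp (contMDiff_const.prodMk contMDiff_id)
  have hval : ContMDiff (𝓡∂ 1) 𝓘(ℝ, ℝ) ∞ (fun t : unitInterval => (t : ℝ)) :=
    contMDiff_subtypeVal_Icc
  have hneg : ContMDiff (𝓡∂ 1) 𝓘(ℝ, ℝ) ∞ (fun t : unitInterval => -(t : ℝ)) :=
    (contDiff_neg (𝕜 := ℝ) (F := ℝ) (n := ∞)).contMDiff.comp hval
  have hcont : ∀ t, IsContactomorphism α.ker (Φ t) := fun t =>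
    { smooth := hslice t
      smooth_inv := hslice (-t)
      preserves := fun x v => by
        -- By the linear equation, `α(dφ_t v)` vanishes at time `t` exactly when it does at time
        -- `0`, where it is `α(v)`.
        have key := eq_zero_iff_of_hasDerivAt
          ((α.continuous_dFun_reeb hh).comp (hint x).continuous)
          (fun t => α.hasDerivAt_form_flow hh hint hsm x v t) t 0
        have hstart : α.form (φ 0 x) (mfderiv 𝓘(ℝ, E) 𝓘(ℝ, E) (φ 0) x v) = α.form x v := by
          rw [hid, mfderiv_id]
          rfl
        rw [hstart] at key
        exact key }
  refine ⟨⟨fun t => Φ t, fun t => hcont t, Equiv.ext h0, ?_, ?_⟩, fun t x => ?_⟩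
  · exact hsm.comp ((hval.comp contMDiff_fst).prodMk contMDiff_snd)
  · exact hsm.comp ((hneg.comp contMDiff_fst).prodMk contMDiff_snd)
  · have h1 := (hint x (t : ℝ)).comp t
      (hval.mdifferentiable (by simp) t).hasMFDerivAt
    have h2 := mfderiv_subtypeVal_Icc_one t
    refine (congrArg (fun L => L (oneTangentSpaceIcc t)) h1.mfderiv).trans ?_
    let X : E := α.contactVectorField h (φ t x)
    refine Eq.trans (congrArg (fun r : ℝ => r • X) h2) ?_
    exact one_smul ℝ X

end Existence

/-! ### Extending functions from a compact submanifold. -/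

section Extension

variable {E : Type*} [NormedAddCommGroup E] [NormedSpace ℝ E]
  {V : Type*} [TopologicalSpace V] [ChartedSpace E V]
  {EY : Type*} [NormedAddCommGroup EY] [NormedSpace ℝ EY]
  {Y : Type*} [TopologicalSpace Y] [ChartedSpace EY Y]
  {ι : Y → V}

/-- A smooth function on an embedded submanifold extends locally. -/
theorem exists_local_extension (hι : Manifold.IsSmoothEmbedding 𝓘(ℝ, EY) 𝓘(ℝ, E) ∞ ι)
    {f : Y → ℝ} (hf : ContMDiff 𝓘(ℝ, EY) 𝓘(ℝ, ℝ) ∞ f) (y₀ : Y) :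
    ∃ U ∈ 𝓝 (ι y₀), ∃ g : V → ℝ, ContMDiffOn 𝓘(ℝ, E) 𝓘(ℝ, ℝ) ∞ g U ∧
      ∀ y, ι y ∈ U → g (ι y) = f y := by
  have him := hι.isImmersion.isImmersionAt y₀
  set φ := him.domChart with hφ
  set ψ := him.codChart with hψ
  -- An immersion chart controls only one sheet of `Y`. Since `ι` is an embedding, points of `Y`
  -- landing in `W` lie in the domain chart, so no other sheet interferes.
  obtain ⟨W, hW, hWφ⟩ := hι.isEmbedding.isInducing.isOpen_iff.mp φ.open_source
  let π : E → EY := fun e => (him.equiv.symm e).1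
  have hπ : ContDiff ℝ ∞ π := contDiff_fst.comp him.equiv.symm.contDiff
  have hchart : ∀ y ∈ φ.source, π (ψ (ι y)) = φ y := fun y hy => by
    have hm : φ y ∈ (φ.extend 𝓘(ℝ, EY)).target := by simpa using φ.map_source hy
    have h1 := him.writtenInCharts hm
    have h2 : ψ (ι y) = him.equiv (φ y, 0) := by
      simpa [← hφ, ← hψ, φ.left_inv hy] using h1
    simp [π, h2]
  have hψs : ContMDiffOn 𝓘(ℝ, E) 𝓘(ℝ, E) ∞ ψ ψ.source :=
    contMDiffOn_of_mem_maximalAtlas him.codChart_mem_maximalAtlas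
  have hφs : ContMDiffOn 𝓘(ℝ, EY) 𝓘(ℝ, EY) ∞ φ.symm φ.target :=
    contMDiffOn_symm_of_mem_maximalAtlas him.domChart_mem_maximalAtlas
  have hπψ : ContMDiffOn 𝓘(ℝ, E) 𝓘(ℝ, EY) ∞ (fun x => π (ψ x)) ψ.source :=
    hπ.contMDiff.comp_contMDiffOn hψs
  have hy₀ : y₀ ∈ φ.source := him.mem_domChart_source
  have hx₀ : ι y₀ ∈ ψ.source := him.mem_codChart_source
  have hopen : IsOpen (ψ.source ∩ (fun x => π (ψ x)) ⁻¹' φ.target) :=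
    hπψ.continuousOn.isOpen_inter_preimage ψ.open_source φ.open_target
  refine ⟨W ∩ (ψ.source ∩ (fun x => π (ψ x)) ⁻¹' φ.target),
    (hW.inter hopen).mem_nhds ⟨?_, hx₀, ?_⟩, fun x => f (φ.symm (π (ψ x))), ?_, ?_⟩
  · change y₀ ∈ ι ⁻¹' W
    rwa [hWφ]
  · rw [mem_preimage, hchart y₀ hy₀]
    exact φ.map_source hy₀
  · exact hf.comp_contMDiffOn (hφs.comp (hπψ.mono fun x hx => hx.2.1) fun x hx => hx.2.2)
  · intro y hy
    have hys : y ∈ φ.source := by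
      rw [← hWφ]
      exact hy.1
    change f (φ.symm (π (ψ (ι y)))) = f y
    rw [hchart y hys, φ.left_inv hys]

variable [FiniteDimensional ℝ E] [IsManifold 𝓘(ℝ, E) ∞ V] [T2Space V] [CompactSpace V]
  [CompactSpace Y]

/-- A smooth function on a compact embedded submanifold `Y` which is positive on `Y ∩ Z` extends to
a smooth function which is positive on `Z`. -/
theorem exists_extension_pos (hι : Manifold.IsSmoothEmbedding 𝓘(ℝ, EY) 𝓘(ℝ, E) ∞ ι)
    {f : Y → ℝ} (hf : ContMDiff 𝓘(ℝ, EY) 𝓘(ℝ, ℝ) ∞ f) {Z : Set V} (hZ : IsClosed Z)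
    (hfZ : ∀ y, ι y ∈ Z → 0 < f y) :
    ∃ g : C^∞⟮𝓘(ℝ, E), V; 𝓘(ℝ, ℝ), ℝ⟯, (∀ y, g (ι y) = f y) ∧ ∀ x ∈ Z, 0 < g x := by
  have hYc : IsClosed (range ι) := (isCompact_range hι.isEmbedding.continuous).isClosed
  -- Both requirements confine the value at each point to a convex set, so local solutions can be
  -- glued by a partition of unity.
  obtain ⟨g, hg⟩ := exists_contMDiffMap_forall_mem_convex_of_local (n := (⊤ : ℕ∞)) 𝓘(ℝ, E)
    (t := fun x => {r : ℝ | ∀ y, ι y = x → r = f y} ∩ {r : ℝ | x ∈ Z → 0 < r}) (fun x => by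
      refine Convex.inter ?_ ?_
      · intro a ha b hb s t _ _ hst y hy
        rw [ha y hy, hb y hy, ← add_smul, hst, one_smul]
      · intro a ha b hb s t hs ht hst hx
        exact (convex_Ioi (0 : ℝ)) (ha hx) (hb hx) hs ht hst) (fun x => by
      by_cases hx : x ∈ range ι
      · obtain ⟨y₀, rfl⟩ := hx
        obtain ⟨U, hU, g, hg, hgf⟩ := exists_local_extension hι hf y₀
        by_cases hZx : ι y₀ ∈ Z
        · have hpos : ∀ᶠ x in 𝓝 (ι y₀), 0 < g x := by
            refine (hg.continuousOn.continuousAt hU).eventually (lt_mem_nhds ?_)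
            rw [hgf y₀ (mem_of_mem_nhds hU)]
            exact hfZ y₀ hZx
          refine ⟨U ∩ {x | 0 < g x}, inter_mem hU hpos, g, hg.mono inter_subset_left, ?_⟩
          rintro x ⟨hxU, hxp⟩
          exact ⟨fun y hy => by subst hy; exact hgf y hxU, fun _ => hxp⟩
        · refine ⟨U ∩ Zᶜ, inter_mem hU (hZ.isOpen_compl.mem_nhds hZx), g,
            hg.mono inter_subset_left, ?_⟩
          rintro x ⟨hxU, hxZ⟩
          exact ⟨fun y hy => by subst hy; exact hgf y hxU, fun h => absurd h hxZ⟩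
      · refine ⟨(range ι)ᶜ, hYc.isOpen_compl.mem_nhds hx, fun _ => 1, contMDiffOn_const, ?_⟩
        intro x hx
        exact ⟨fun y hy => absurd ⟨y, hy⟩ hx, fun _ => one_pos⟩)
  exact ⟨g, fun y => (hg (ι y)).1 y rfl, fun x hx => (hg x).2 hx⟩

/-- A smooth function on a compact embedded submanifold `Y` which vanishes near `Y ∩ Z` extends to
a smooth function which vanishes on `Z`. -/
theorem exists_extension_zero (hι : Manifold.IsSmoothEmbedding 𝓘(ℝ, EY) 𝓘(ℝ, E) ∞ ι)
    {f : Y → ℝ} (hf : ContMDiff 𝓘(ℝ, EY) 𝓘(ℝ, ℝ) ∞ f) {Z : Set V} (hZ : IsClosed Z)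
    (hfZ : ∀ y, ι y ∈ Z → ∀ᶠ y' in 𝓝 y, f y' = 0) :
    ∃ g : C^∞⟮𝓘(ℝ, E), V; 𝓘(ℝ, ℝ), ℝ⟯, (∀ y, g (ι y) = f y) ∧ ∀ x ∈ Z, g x = 0 := by
  have hYc : IsClosed (range ι) := (isCompact_range hι.isEmbedding.continuous).isClosed
  obtain ⟨g, hg⟩ := exists_contMDiffMap_forall_mem_convex_of_local (n := (⊤ : ℕ∞)) 𝓘(ℝ, E)
    (t := fun x => {r : ℝ | ∀ y, ι y = x → r = f y} ∩ {r : ℝ | x ∈ Z → r = 0}) (fun x => by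
      refine Convex.inter ?_ ?_
      · intro a ha b hb s t _ _ hst y hy
        rw [ha y hy, hb y hy, ← add_smul, hst, one_smul]
      · intro a ha b hb s t _ _ _ hx
        rw [ha hx, hb hx, smul_zero, smul_zero, add_zero]) (fun x => by
      by_cases hx : x ∈ range ι
      · obtain ⟨y₀, rfl⟩ := hx
        by_cases hZx : ι y₀ ∈ Z
        -- The local solution `0` must agree with `f` at all nearby points of `Y`, so vanishing of
        -- `f` only on `Y ∩ Z` would not suffice.
        · have h0 := hfZ y₀ hZx
          rw [hι.isEmbedding.nhds_eq_comap, eventually_comap] at h0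
          refine ⟨_, h0, fun _ => 0, contMDiffOn_const, ?_⟩
          intro x hx
          exact ⟨fun y hy => (hx y hy).symm, fun _ => rfl⟩
        · obtain ⟨U, hU, g, hg, hgf⟩ := exists_local_extension hι hf y₀
          refine ⟨U ∩ Zᶜ, inter_mem hU (hZ.isOpen_compl.mem_nhds hZx), g,
            hg.mono inter_subset_left, ?_⟩
          rintro x ⟨hxU, hxZ⟩
          exact ⟨fun y hy => by subst hy; exact hgf y hxU, fun h => absurd h hxZ⟩
      · refine ⟨(range ι)ᶜ, hYc.isOpen_compl.mem_nhds hx, fun _ => 0, contMDiffOn_const, ?_⟩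
        intro x hx
        exact ⟨fun y hy => absurd ⟨y, hy⟩ hx, fun _ => rfl⟩)
  exact ⟨g, fun y => (hg (ι y)).1 y rfl, fun x hx => (hg x).2 hx⟩

end Extension

/-! ### Smooth truncation near zero. -/

section Truncation

/-- A smooth approximation of the identity of `ℝ` that vanishes on `[-ε, ε]`. -/
noncomputable def truncation (ε x : ℝ) : ℝ := x * Real.smoothTransition ((x / ε) ^ 2 - 1)

theorem contDiff_truncation (ε : ℝ) : ContDiff ℝ ∞ (truncation ε) :=
  contDiff_id.mul (Real.smoothTransition.contDiff.comp
    (((contDiff_id.div_const ε).pow 2).sub contDiff_const))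

theorem truncation_eq_zero {ε x : ℝ} (hε : 0 < ε) (hx : |x| ≤ ε) : truncation ε x = 0 := by
  have h : (x / ε) ^ 2 ≤ 1 := by
    rw [sq_le_one_iff_abs_le_one, abs_div, abs_of_pos hε]
    exact div_le_one_of_le₀ hx hε.le
  rw [truncation, Real.smoothTransition.zero_of_nonpos (by linarith), mul_zero]

/-- The cutoff factor is `1` once `|x| ≥ √2 ε`, so for `|x| ≥ 2ε` there is no error, and for smaller
`|x|` the error is at most `|x|`. -/
theorem abs_truncation_sub_le {ε : ℝ} (hε : 0 < ε) (x : ℝ) : |x - truncation ε x| ≤ 2 * ε := by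
  have hf : x - truncation ε x = x * (1 - Real.smoothTransition ((x / ε) ^ 2 - 1)) := by
    rw [truncation]
    ring
  rw [hf]
  rcases le_total |x| (2 * ε) with hx | hx
  · have h0 := Real.smoothTransition.nonneg ((x / ε) ^ 2 - 1)
    have h1 := Real.smoothTransition.le_one ((x / ε) ^ 2 - 1)
    rw [abs_mul, abs_of_nonneg (by linarith : 0 ≤ 1 - Real.smoothTransition ((x / ε) ^ 2 - 1))]
    exact (mul_le_of_le_one_right (abs_nonneg x) (by linarith)).trans hx
  · have h2 : 2 ≤ |x / ε| := by
      rw [abs_div, abs_of_pos hε, le_div_iff₀ hε]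
      exact hx
    have h3 : 1 ≤ (x / ε) ^ 2 - 1 := by
      rw [← sq_abs]
      nlinarith
    rw [Real.smoothTransition.one_of_one_le h3, sub_self, mul_zero, abs_zero]
    positivity

end Truncation

end ContactReduction

/-! ### The reduction theorem. -/

theorem mainTheorem6
    {E : Type*} [NormedAddCommGroup E] [NormedSpace ℝ E] [FiniteDimensional ℝ E]
    {V : Type*} [TopologicalSpace V] [T2Space V] [CompactSpace V] [ConnectedSpace V]
    [ChartedSpace E V] [IsManifold 𝓘(ℝ, E) ∞ V]
    {EB : Type*} [NormedAddCommGroup EB] [NormedSpace ℝ EB] [FiniteDimensional ℝ EB]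
    {B : Type*} [TopologicalSpace B] [T2Space B] [CompactSpace B] [ConnectedSpace B]
    [ChartedSpace EB B] [IsManifold 𝓘(ℝ, EB) ∞ B]
    {EY : Type*} [NormedAddCommGroup EY] [NormedSpace ℝ EY] [FiniteDimensional ℝ EY]
    {Y : Type*} [TopologicalSpace Y] [CompactSpace Y]
    [ChartedSpace EY Y] [IsManifold 𝓘(ℝ, EY) ∞ Y]
    {EF : Type*} [NormedAddCommGroup EF] [NormedSpace ℝ EF] [FiniteDimensional ℝ EF]
    {F : Type*} [TopologicalSpace F] [ChartedSpace EF F] [IsManifold 𝓘(ℝ, EF) ∞ F]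
    (α : ContactForm E V) (β : ContactForm EB B)
    (ι : Y → V) (hι : Manifold.IsSmoothEmbedding 𝓘(ℝ, EY) 𝓘(ℝ, E) ∞ ι)
    (hY : IsStrictlyCoisotropic EY α ι)
    (ρ : Y → B) (hρ : IsSmoothFiberBundle EB EY EF F ρ) (hαβ : PullbackEq EY α β ι ρ)
    (μ : UnivCont α.ker → ℝ) (hμ : IsQuasimorphism μ) (hmono : α.IsMonotone μ)
    (hcont : α.IsC0Continuous μ) (hYsub : α.IsSubheavy μ (range ι))
    (ν : UnivCont β.ker → ℝ) (hν : IsInducedBy α β ι ρ μ ν)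
    (Z : Set V) :
    (α.IsSubheavy μ Z → β.IsSubheavy ν (ρ '' (ι ⁻¹' Z))) ∧
    (α.IsSuperheavy μ Z → β.IsSuperheavy ν (ρ '' (ι ⁻¹' Z))) := by
  have hkρ : ∀ k : C^∞⟮𝓘(ℝ, EB), B; 𝓘(ℝ, ℝ), ℝ⟯, ContMDiff 𝓘(ℝ, EY) 𝓘(ℝ, ℝ) ∞ (fun y => k (ρ y)) :=
    fun k => k.contMDiff.comp hρ.smooth
  have hclosed : IsClosed Z → IsClosed (ρ '' (ι ⁻¹' Z)) := fun hZ =>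
    ((hZ.preimage hι.isEmbedding.continuous).isCompact.image hρ.smooth.continuous).isClosed
  refine ⟨fun hZ => ⟨hclosed hZ.1, fun k hk ψ hψ => ?_⟩,
    fun hZ => ⟨hclosed hZ.1, fun k hk ψ hψ => ?_⟩⟩
  -- With the empty set in place of `Z`, positivity is void and this is plain extension.
  · obtain ⟨h, hext, -⟩ := exists_extension_pos hι (hkρ k) isClosed_empty
      (fun y hy => absurd hy (notMem_empty _))
    obtain ⟨φ, hφ⟩ := α.exists_generates h
    let ε : ℕ → ℝ := fun n => 1 / ((n : ℝ) + 1)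
    have hε : ∀ n, 0 < ε n := fun n => Nat.one_div_pos_of_nat
    let T : ℕ → C^∞⟮𝓘(ℝ, ℝ), ℝ; 𝓘(ℝ, ℝ), ℝ⟯ := fun n =>
      ⟨truncation (ε n), (contDiff_truncation (ε n)).contMDiff⟩
    choose φn hφn using fun n => α.exists_generates ((T n).comp h)
    choose ψn hψn using fun n => β.exists_generates ((T n).comp k)
    -- The function `T n ∘ h` need not vanish on `Z`. Another extension `g` of the same reduced
    -- Hamiltonian does, and both have the `μ`-value that `ν` assigns to `ψn n`.
    have hzero : ∀ n, μ (isotopyClass (φn n)) = 0 := fun n => by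
      obtain ⟨g, hgext, hgZ⟩ := exists_extension_zero hι (hkρ ((T n).comp k)) hZ.1 (fun y hy => by
        have hky : k (ρ y) = 0 := hk _ ⟨y, hy, rfl⟩
        have hlt : ∀ᶠ y' in 𝓝 y, |k (ρ y')| < ε n :=
          (hkρ k).continuous.abs.continuousAt.eventually
            (gt_mem_nhds (by simpa [hky] using hε n))
        exact hlt.mono fun y' hy' => truncation_eq_zero (hε n) hy'.le)
      obtain ⟨χ, hχ⟩ := α.exists_generates g
      have h1 := hν (autonomous ((T n).comp h)) (autonomous ((T n).comp k))
        (fun _ y => congrArg (truncation (ε n)) (hext y)) (φn n) (ψn n) (hφn n) (hψn n)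
      have h2 := hν (autonomous g) (autonomous ((T n).comp k))
        (fun _ y => hgext y) χ (ψn n) hχ (hψn n)
      rw [← h1, h2, hZ.2 g hgZ χ hχ]
    -- The limit is taken on `V`, where continuity of `μ` is available.
    have hlim : TendstoUniformly (fun n p => autonomous ((T n).comp h) p)
        (fun p => autonomous h p) atTop := by
      rw [Metric.tendstoUniformly_iff]
      intro δ hδ
      have hε0 : Tendsto (fun n => 2 * ε n) atTop (𝓝 0) := by
        simpa [ε] using tendsto_one_div_add_atTop_nhds_zero_nat.const_mul (2 : ℝ)
      filter_upwards [hε0.eventually (gt_mem_nhds hδ)] with n hn p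
      exact (abs_truncation_sub_le (hε n) (h p.2)).trans_lt hn
    have ht := hcont _ _ hlim φ φn hφ hφn
    simp only [hzero] at ht
    rw [hν (autonomous h) (autonomous k) (fun _ y => hext y) φ ψ hφ hψ]
    exact tendsto_nhds_unique ht tendsto_const_nhds
  -- Strict positivity persists near `Y ∩ Z`, so no truncation or limit is needed.
  · obtain ⟨h, hext, hpos⟩ := exists_extension_pos hι (hkρ k) hZ.1
      (fun y hy => hk _ ⟨y, hy, rfl⟩)
    obtain ⟨φ, hφ⟩ := α.exists_generates h
    rw [hν (autonomous h) (autonomous k) (fun _ y => hext y) φ ψ hφ hψ]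
    exact hZ.2 h hpos φ hφ
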